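/- For a Borel probability measure $\mu$ on $\mathbb{R}$ with $\mathrm{Supp}(\mu)\subset[0,1]$ put $d_\mu(x)=\liminf_{r\to0}\frac{\log\mu(B(x,r))}{\log r}$ for $x\in\mathrm{Supp}(\mu)$, $D_\mu(\alpha)=\{x\in\mathrm{Supp}(\mu): d_\mu(x)=\alpha\}$, and $\dim_H\mu=\inf\{\dim_H Z:\mu(Z)=1\}$. Let $\mathcal G_j$ be the set of dyadic intervals $[k2^{-j},(k+1)2^{-j})$, $0\le k<2^j$. For $\alpha\ge0$ and $q\in\mathbb{R}$ define - the multifractal spectrum $f_\mu(\alpha)=\dim_H D_\mu(\alpha)$ if $D_\mu(\alpha)\ne\varnothing$, and $f_\mu(\alpha)=-\infty$ otherwise; - the large deviations spectrum $LD_\mu(\alpha)=\lim_{\varepsilon\to0^+}\liminf_{j\to\infty}\frac1j\log_2 N_j(\alpha,\varepsilon)$, where $N_j(\alpha,\varepsilon)=\#\{I\in\mathcal G_j: 2^{-j(\alpha+\varepsilon)}\le\mu(I)\le2^{-j(\alpha-\varepsilon)}\}$ and $\log_2 0=-\infty$; - the scaling function $\tau_\mu(q)=\liminf_{j\to\infty}\frac1{-j}\log_2\sum_{I\in\mathcal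 G_j,\ \mu(I)\ne0}\mu(I)^q$ and the Legendre spectrum $L_\mu(\alpha)=\inf_{q\in\mathbb{R}}(q\alpha-\tau_\mu(q))$. Theorem. Let $0\le a<b\le1$. There is a Borel probability measure $\mu$ whose support $K$ is a Cantor set (nonempty, compact, perfect, totally disconnected) contained in $[0,1]$, such that every non-empty relatively open subset of $K$ has positive $\mu$-measure, $\dim_H\mu=b$, the set $S=\{d_\mu(x):x\in K\}$ satisfies $\min S=a$ and $\max S=b$ and is the image of the middle-third Cantor set under $t\mapsto a+(b-a)t$, $D_\mu(\alpha)$ has at most one point for every $\alpha\ge0$, and moreover: i) $f_\mu(\alpha)=0$ for every $\alpha\in S$, and $f_\mu(\alpha)=-\infty$ for every $\alpha\in[a,b]\setminus S$; ii) $LD_\mu(\alpha)=\alpha$ for every $\alpha\in S$, and $LD_\mu(\alpha)=-\infty$ for every $\alpha\in[0,\infty)\setminus S$; iii) $L_\mu(\alpha)=\alpha$ for every $\alpha\in[a,b]$, and $L_\mu(\alpha)=-\infty$ for every $\alpha\in[0,\infty)\setminus[a,b]$; the scaling function is $\tau_\mu(q)=b(q-1)$ for $q\le1$ and $\tau_\mu(q)=a(q-1)$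 for $q>1$. In particular the three spectra are pairwise different on $[a,b]$, and the multifractal formalism fails at every positive exponent of $[a,b]$: $f_\mu(\alpha)\ne L_\mu(\alpha)$ for all $\alpha\in[a,b]$ with $\alpha>0$. -/

import Mathlib

open MeasureTheory Set Filter Topology

noncomputable section

namespace Multifractal

/-- A Cantor set: a nonempty, compact, perfect, totally disconnected set of real numbers. -/
structure IsCantorSet (K : Set ℝ) : Prop where
  nonempty : K.Nonempty
  isCompact : IsCompact K
  perfect : Perfect K
  isTotallyDisconnected : IsTotallyDisconnected K

/-- The lower local dimension `d_μ(x) = liminf_{r → 0} log μ(B(x,r)) / log r`, for `x` in the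
support of `μ`. -/
def localDim (μ : Measure ℝ) (x : ℝ) : EReal :=
  liminf (fun r : ℝ => ((Real.log (μ.real (Metric.ball x r)) / Real.log r : ℝ) : EReal)) (𝓝[>] 0)

/-- The level set `D_μ(α) = {x ∈ Supp μ : d_μ(x) = α}`. -/
def levelSet (μ : Measure ℝ) (α : ℝ) : Set ℝ :=
  {x | x ∈ μ.support ∧ localDim μ x = (α : EReal)}

/-- The set `{d_μ(x) : x ∈ Supp μ}`, the support of the multifractal spectrum of `μ`. -/
def exponents (μ : Measure ℝ) : Set EReal := localDim μ '' μ.support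

open scoped Classical in
/-- The multifractal spectrum `f_μ`: the Hausdorff dimension of the level set `D_μ(α)`,
or `-∞` when the level set is empty. -/
def multifractalSpectrum (μ : Measure ℝ) (α : ℝ) : EReal :=
  if levelSet μ α = ∅ then ⊥ else (dimH (levelSet μ α) : EReal)

/-- The Hausdorff dimension of a probability measure: `inf {dim_H Z : μ(Z) = 1}`. -/
def dimMeasure (μ : Measure ℝ) : ENNReal :=
  ⨅ (Z : Set ℝ) (_ : MeasurableSet Z ∧ μ Z = 1), dimH Z

/-- The dyadic interval `[k 2^{-j}, (k+1) 2^{-j})`; those of generation `j` in `[0,1]` are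
obtained for `k < 2^j`. -/
def dyadic (j k : ℕ) : Set ℝ := Ico ((k : ℝ) / 2 ^ j) (((k : ℝ) + 1) / 2 ^ j)

open scoped Classical in
/-- The logarithm in base two of a nonnegative real number, with `log₂ 0 = -∞`. -/
def log2 (x : ℝ) : EReal := if x = 0 then ⊥ else ((Real.logb 2 x : ℝ) : EReal)

open scoped Classical in
/-- The scaling function `τ_μ(q) = liminf_j (1/(-j)) log₂ ∑ μ(I)^q`, where the sum runs over the
dyadic intervals of generation `j` with non-zero mass. -/
def scalingFunction (μ : Measure ℝ) (q : ℝ) : EReal :=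
  liminf (fun j : ℕ =>
    log2 (∑ k ∈ (Finset.range (2 ^ j)).filter (fun k => μ.real (dyadic j k) ≠ 0),
      μ.real (dyadic j k) ^ q) / ((-(j : ℝ) : ℝ) : EReal)) atTop

/-- The Legendre spectrum `L_μ(α) = inf_{q ∈ ℝ} (q α - τ_μ(q))`. -/
def legendreSpectrum (μ : Measure ℝ) (α : ℝ) : EReal :=
  ⨅ q : ℝ, ((q * α : ℝ) : EReal) - scalingFunction μ q

open scoped Classical in
/-- The number `N_j(α, ε)` of dyadic intervals `I` of generation `j` with
`2^{-j(α+ε)} ≤ μ(I) ≤ 2^{-j(α-ε)}`. -/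
def dyadicCount (μ : Measure ℝ) (α ε : ℝ) (j : ℕ) : ℕ :=
  ((Finset.range (2 ^ j)).filter (fun k =>
    (2 : ℝ) ^ (-((j : ℝ) * (α + ε))) ≤ μ.real (dyadic j k) ∧
      μ.real (dyadic j k) ≤ (2 : ℝ) ^ (-((j : ℝ) * (α - ε))))).card

/-- The exponential growth rate `liminf_j log₂ N_j(α, ε) / j`. -/
def dyadicRate (μ : Measure ℝ) (α ε : ℝ) : EReal :=
  liminf (fun j : ℕ => log2 (dyadicCount μ α ε j : ℝ) / ((j : ℝ) : EReal)) atTop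

/-- The large deviations spectrum `LD_μ(α) = lim_{ε → 0} liminf_j log₂ N_j(α, ε) / j`. -/
def largeDeviations (μ : Measure ℝ) (α : ℝ) : EReal :=
  limUnder (𝓝[>] (0 : ℝ)) (dyadicRate μ α)

theorem dyadicCount_mono (μ : Measure ℝ) (α : ℝ) (j : ℕ) :
    Monotone (fun ε => dyadicCount μ α ε j) := by
  intro ε ε' h
  unfold dyadicCount
  apply Finset.card_le_card
  intro k hk
  rw [Finset.mem_filter] at hk ⊢
  have hj : (0 : ℝ) ≤ j := Nat.cast_nonneg j
  refine ⟨hk.1, le_trans ?_ hk.2.1, hk.2.2.trans ?_⟩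
  · exact Real.rpow_le_rpow_of_exponent_le (by norm_num) (by nlinarith)
  · exact Real.rpow_le_rpow_of_exponent_le (by norm_num) (by nlinarith)

theorem log2_natCast_mono {m n : ℕ} (h : m ≤ n) : log2 (m : ℝ) ≤ log2 (n : ℝ) := by
  unfold log2
  by_cases hm : m = 0
  · simp [hm]
  · have hm' : 0 < m := Nat.pos_of_ne_zero hm
    have hn : n ≠ 0 := by omega
    rw [if_neg (by exact_mod_cast hm), if_neg (by exact_mod_cast hn)]
    exact_mod_cast Real.logb_le_logb_of_le (by norm_num) (by exact_mod_cast hm')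
      (by exact_mod_cast h)

theorem dyadicRate_mono (μ : Measure ℝ) (α : ℝ) : Monotone (dyadicRate μ α) := by
  intro ε ε' h
  unfold dyadicRate
  refine liminf_le_liminf (Eventually.of_forall fun j => ?_)
  exact EReal.div_le_div_right_of_nonneg (by exact_mod_cast Nat.cast_nonneg (α := ℝ) j)
    (log2_natCast_mono (dyadicCount_mono μ α j h))

/-- The limit in the definition of the large deviations spectrum always exists. -/
theorem tendsto_dyadicRate (μ : Measure ℝ) (α : ℝ) :
    Tendsto (dyadicRate μ α) (𝓝[>] 0) (𝓝 (largeDeviations μ α)) :=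
  tendsto_nhds_limUnder
    ⟨_, (dyadicRate_mono μ α).tendsto_nhdsGT 0⟩

end Multifractal

end

/-! ### Dyadic intervals and the masses they carry. -/

namespace Multifractal

/-! The proof separates analysis from construction. Suppose a dyadic interval of generation `j`
around a support point `x` has mass `2^(-j(A x + o(1)))`, uniformly in `x`, with `A` continuous on a
compact support (`HasUniformExponent`). Then `A x` is the local dimension. A neighbourhood of `x`
has fixed positive mass, spread over intervals of mass about `2^(-j A x)`, so about `2^(j A x)` of
them occur: the large deviations spectrum is the identity on the image of `A`, and `-∞` off this
closed set. Writing `μ(I)^q = μ(I) μ(I)^(q-1)` turns the scaling sum into a mass-weighted average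
governed by the least value of `A (q-1)`, hence by `max A` for `q ≤ 1` and `min A` for `q > 1`. The
mass distribution principle near a maximum of `A` gives the dimension of `μ`.

It remains to make `A` injective with image a Cantor set. Toss fair coins `ω`; the exponent of `ω`
is `a + (b-a)t`, where `t` has ternary digits `2 ω n`. The point coded by `ω` carries the `n`-th bit
at the binary place `⌈n/u⌉ + √n` (integer square root), where `u` is the largest exponent compatible
with the first `n` bits. The place depends only on earlier bits, so `ω` can be decoded successively,
and the first `j` digits reveal about `j` times the exponent many bits (`bitCount_asymptotics`). A
charged dyadic interval is thus a cylinder of the expected mass. The upper approximation `u` is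
positive even at exponent `0`, and decreases with `n`, which keeps the places increasing; the term
`√n` forces infinitely many zero digits at negligible cost. -/

theorem mem_dyadic_iff {j k : ℕ} {x : ℝ} : x ∈ dyadic j k ↔ 0 ≤ x ∧ ⌊2 ^ j * x⌋₊ = k := by
  have h2 : (0 : ℝ) < 2 ^ j := by positivity
  unfold dyadic
  rw [mem_Ico, div_le_iff₀ h2, lt_div_iff₀ h2, mul_comm x]
  constructor
  · rintro ⟨h₁, h₂⟩
    have hx : 0 ≤ x := by
      by_contra! hx
      have : 2 ^ j * x < 0 := mul_neg_of_pos_of_neg h2 hx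
      linarith [Nat.cast_nonneg (α := ℝ) k]
    exact ⟨hx, (Nat.floor_eq_iff (by positivity)).2 ⟨h₁, h₂⟩⟩
  · rintro ⟨hx, h⟩
    exact (Nat.floor_eq_iff (by positivity)).1 h

theorem measurableSet_dyadic (j k : ℕ) : MeasurableSet (dyadic j k) := measurableSet_Ico

theorem exists_mem_dyadic (j : ℕ) {x : ℝ} (hx : x ∈ Ico (0 : ℝ) 1) :
    ∃ k < 2 ^ j, x ∈ dyadic j k := by
  refine ⟨⌊2 ^ j * x⌋₊, ?_, mem_dyadic_iff.2 ⟨hx.1, rfl⟩⟩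
  have h2 : (0 : ℝ) < 2 ^ j := by positivity
  rw [Nat.floor_lt (mul_nonneg h2.le hx.1)]
  push_cast
  nlinarith [hx.2]

theorem dist_lt_of_mem_dyadic {j k : ℕ} {x y : ℝ} (hx : x ∈ dyadic j k) (hy : y ∈ dyadic j k) :
    |x - y| < (2 ^ j)⁻¹ := by
  have h : ((k : ℝ) + 1) / 2 ^ j = (k : ℝ) / 2 ^ j + (2 ^ j)⁻¹ := by ring
  unfold dyadic at hx hy
  rw [mem_Ico, h] at hx hy
  rw [abs_lt]
  constructor <;> linarith [hx.1, hx.2, hy.1, hy.2]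

theorem disjoint_dyadic (j : ℕ) {k l : ℕ} (h : k ≠ l) : Disjoint (dyadic j k) (dyadic j l) :=
  disjoint_left.2 fun _ hx hy => h ((mem_dyadic_iff.1 hx).2.symm.trans (mem_dyadic_iff.1 hy).2)

theorem sum_measureReal_dyadic_le_one (μ : Measure ℝ) [IsProbabilityMeasure μ] (j : ℕ)
    (F : Finset ℕ) : ∑ k ∈ F, μ.real (dyadic j k) ≤ 1 := by
  rw [← measureReal_biUnion_finset (fun k _ l _ h => disjoint_dyadic j h)
    (fun k _ => measurableSet_dyadic j k)]
  exact measureReal_le_one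

theorem measureReal_inter_support (μ : Measure ℝ) (s : Set ℝ) :
    μ.real (s ∩ μ.support) = μ.real s := by
  unfold Measure.real
  rw [measure_inter_conull Measure.measure_compl_support]

/-- A measure on `[0,1)` whose mass on dyadic intervals is governed, uniformly in the interval,
by a continuous exponent `A` on the support. -/
structure HasUniformExponent (μ : Measure ℝ) (A : ℝ → ℝ) : Prop where
  isCompact_support : IsCompact μ.support
  support_subset : μ.support ⊆ Ico 0 1
  continuousOn : ContinuousOn A μ.support
  dyadic_bounds : ∀ ε > 0, ∀ᶠ j : ℕ in atTop, ∀ k, ∀ x ∈ μ.support, x ∈ dyadic j k →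
    (2 : ℝ) ^ (-((j : ℝ) * (A x + ε))) ≤ μ.real (dyadic j k) ∧
      μ.real (dyadic j k) ≤ (2 : ℝ) ^ (-((j : ℝ) * (A x - ε)))

theorem exists_mem_support_of_measureReal_ne_zero {μ : Measure ℝ} {s : Set ℝ}
    (h : μ.real s ≠ 0) : ∃ x ∈ μ.support, x ∈ s := by
  have : 0 < μ s := by
    rw [pos_iff_ne_zero]
    intro h0
    exact h (by simp [Measure.real, h0])
  obtain ⟨x, hx, hx'⟩ := Measure.nonempty_inter_support_of_pos this
  exact ⟨x, hx', hx⟩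

/-! ### Consequences of a uniform continuous exponent. -/

namespace HasUniformExponent

variable {μ : Measure ℝ} [IsProbabilityMeasure μ] {A : ℝ → ℝ}

/-- Near a point of the support, dyadic intervals with the exponent of that point carry a
definite mass. -/
theorem exists_mass_le_sum (h : HasUniformExponent μ A) {x : ℝ} (hx : x ∈ μ.support) {ε : ℝ}
    (hε : 0 < ε) : ∃ c > 0, ∀ᶠ j : ℕ in atTop, ∃ F ⊆ Finset.range (2 ^ j),
      (∀ k ∈ F, (2 : ℝ) ^ (-((j : ℝ) * (A x + ε))) ≤ μ.real (dyadic j k) ∧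
        μ.real (dyadic j k) ≤ (2 : ℝ) ^ (-((j : ℝ) * (A x - ε)))) ∧
      c ≤ ∑ k ∈ F, μ.real (dyadic j k) := by
  classical
  obtain ⟨δ, hδ, hA⟩ := Metric.continuousOn_iff.1 h.continuousOn x hx (ε / 2) (half_pos hε)
  have hV : 0 < μ (Metric.ball x δ) :=
    (Measure.mem_support_iff_forall x).1 hx _ (Metric.ball_mem_nhds x hδ)
  -- The constant is the mass of a ball on which `A` varies by less than `ε / 2`, so it is
  -- independent of `j`; the selected intervals meet the support inside this ball.
  refine ⟨μ.real (Metric.ball x δ), ENNReal.toReal_pos hV.ne' (measure_ne_top _ _), ?_⟩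
  filter_upwards [h.dyadic_bounds (ε / 2) (half_pos hε)] with j hj
  refine ⟨(Finset.range (2 ^ j)).filter
    (fun k => ∃ y ∈ μ.support, y ∈ Metric.ball x δ ∧ y ∈ dyadic j k), Finset.filter_subset _ _,
    ?_, ?_⟩
  · intro k hk
    obtain ⟨-, y, hy, hyx, hyk⟩ := Finset.mem_filter.1 hk
    have hd := hA y hy hyx
    rw [Real.dist_eq, abs_lt] at hd
    obtain ⟨h₁, h₂⟩ := hj k y hy hyk
    have hj0 : (0 : ℝ) ≤ j := Nat.cast_nonneg j
    refine ⟨le_trans ?_ h₁, h₂.trans ?_⟩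
    · exact Real.rpow_le_rpow_of_exponent_le (by norm_num) (by nlinarith)
    · exact Real.rpow_le_rpow_of_exponent_le (by norm_num) (by nlinarith)
  · rw [← measureReal_inter_support]
    refine (measureReal_mono ?_ ?_).trans (measureReal_biUnion_finset_le _ _)
    · rintro y ⟨hy, hys⟩
      obtain ⟨k, hk, hyk⟩ := exists_mem_dyadic j (h.support_subset hys)
      exact mem_iUnion₂.2 ⟨k, Finset.mem_filter.2 ⟨Finset.mem_range.2 hk, y, hys, hy, hyk⟩, hyk⟩
    · exact measure_ne_top _ _

/-! ### Local dimension -/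

/-- The ball contains the dyadic interval around `x` of generation `⌈-log₂ r⌉`; rounding the
generation costs a bounded exponent, absorbed by `ε` for small `r`. -/
theorem rpow_le_measureReal_ball (h : HasUniformExponent μ A) {x : ℝ} (hx : x ∈ μ.support)
    {ε : ℝ} (hε : 0 < ε) :
    ∀ᶠ r : ℝ in 𝓝[>] 0, r ^ (A x + ε) ≤ μ.real (Metric.ball x r) := by
  have hL : Tendsto (fun r : ℝ => -Real.logb 2 r) (𝓝[>] 0) atTop :=
    tendsto_neg_atBot_atTop.comp (Real.tendsto_logb_nhdsGT_zero (by norm_num))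
  have hj : Tendsto (fun r : ℝ => ⌈-Real.logb 2 r⌉₊) (𝓝[>] 0) atTop :=
    tendsto_nat_ceil_atTop.comp hL
  filter_upwards [hj.eventually (h.dyadic_bounds (ε / 2) (half_pos hε)),
    hL.eventually_ge_atTop (max 0 (|A x + ε / 2| / (ε / 2))), self_mem_nhdsWithin] with r hb hr hr0
  have hr0 : 0 < r := hr0
  set L := -Real.logb 2 r with hLdef
  have hrL : r = (2 : ℝ) ^ (-L) := by
    rw [hLdef, neg_neg, Real.rpow_logb (by norm_num) (by norm_num) hr0]
  have hL0 : 0 ≤ L := (le_max_left _ _).trans hr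
  have hL1 : |A x + ε / 2| ≤ L * (ε / 2) := by
    rw [← div_le_iff₀ (half_pos hε)]
    exact (le_max_right _ _).trans hr
  set j := ⌈L⌉₊
  have hjL : L ≤ j := Nat.le_ceil L
  have hjL' : (j : ℝ) < L + 1 := Nat.ceil_lt_add_one hL0
  obtain ⟨k, -, hk⟩ := exists_mem_dyadic j (h.support_subset hx)
  have hsub : dyadic j k ⊆ Metric.ball x r := by
    intro y hy
    rw [Metric.mem_ball, Real.dist_eq]
    refine (dist_lt_of_mem_dyadic hy hk).trans_le ?_
    rw [hrL, ← Real.rpow_natCast, ← Real.rpow_neg (by norm_num)]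
    exact Real.rpow_le_rpow_of_exponent_le (by norm_num) (by linarith)
  refine le_trans ?_ ((hb k x hx hk).1.trans (measureReal_mono hsub (measure_ne_top _ _)))
  rw [hrL, ← Real.rpow_mul (by norm_num)]
  refine Real.rpow_le_rpow_of_exponent_le (by norm_num) ?_
  have h1 := le_abs_self (A x + ε / 2)
  have h2 : ((j : ℝ) - L) * (A x + ε / 2) ≤ |A x + ε / 2| := by
    calc ((j : ℝ) - L) * (A x + ε / 2) ≤ ((j : ℝ) - L) * |A x + ε / 2| := by gcongr
      _ ≤ 1 * |A x + ε / 2| := by gcongr; linarith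
      _ = _ := one_mul _
  nlinarith

/-- Sets of small diameter contained in a region where the exponent is at least `t` have mass at
most a power of their size. -/
theorem exists_measureReal_le_rpow (h : HasUniformExponent μ A) {W : Set ℝ} {t : ℝ}
    (hW : ∀ y ∈ W, y ∈ μ.support → t ≤ A y) {ε : ℝ} (hε : 0 < ε) :
    ∃ r₀ > 0, ∀ x ∈ μ.support, ∀ r : ℝ, 0 < r → r < r₀ → ∀ s ⊆ W, s ⊆ Metric.closedBall x r →
      μ.real s ≤ r ^ (t - ε) := by
  classical
  have hL : Tendsto (fun r : ℝ => -Real.logb 2 r) (𝓝[>] 0) atTop :=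
    tendsto_neg_atBot_atTop.comp (Real.tendsto_logb_nhdsGT_zero (by norm_num))
  have hj : Tendsto (fun r : ℝ => ⌊-Real.logb 2 r⌋₊) (𝓝[>] 0) atTop :=
    tendsto_nat_floor_atTop.comp hL
  have key : ∀ᶠ r : ℝ in 𝓝[>] 0, ∀ x ∈ μ.support, ∀ s ⊆ W, s ⊆ Metric.closedBall x r →
      μ.real s ≤ r ^ (t - ε) := by
    filter_upwards [hj.eventually (h.dyadic_bounds (ε / 2) (half_pos hε)),
      hL.eventually_ge_atTop (max 0 ((|t - ε / 2| + 2) / (ε / 2))), self_mem_nhdsWithin]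
      with r hb hr hr0 x hx s hsW hs
    have hr0 : 0 < r := hr0
    set L := -Real.logb 2 r with hLdef
    have hrL : r = (2 : ℝ) ^ (-L) := by
      rw [hLdef, neg_neg, Real.rpow_logb (by norm_num) (by norm_num) hr0]
    have hL0 : 0 ≤ L := (le_max_left _ _).trans hr
    have hL1 : |t - ε / 2| + 2 ≤ L * (ε / 2) := by
      rw [← div_le_iff₀ (half_pos hε)]
      exact (le_max_right _ _).trans hr
    set j := ⌊L⌋₊
    have hjL : (j : ℝ) ≤ L := Nat.floor_le hL0
    have hjL' : L < j + 1 := Nat.lt_floor_add_one L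
    have hrj : 2 ^ j * r ≤ 1 := by
      rw [hrL, ← Real.rpow_natCast, ← Real.rpow_add (by norm_num)]
      exact Real.rpow_le_one_of_one_le_of_nonpos (by norm_num) (by linarith)
    have h2j : (0 : ℝ) < 2 ^ j := by positivity
    obtain ⟨k, -, hk⟩ := exists_mem_dyadic j (h.support_subset hx)
    have hk' := hk
    unfold dyadic at hk'
    rw [mem_Ico, div_le_iff₀ h2j, lt_div_iff₀ h2j] at hk'
    -- Since `r ≤ 2^(-j)`, only the interval of `x` and its neighbours can meet `s`. Keeping those
    -- with a support point in `s` makes the lower bound `t` on the exponent available.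
    set F := (Finset.Icc (k - 1) (k + 1)).filter
      (fun i => ∃ y ∈ μ.support, y ∈ s ∧ y ∈ dyadic j i)
    have hcover : s ∩ μ.support ⊆ ⋃ i ∈ F, dyadic j i := by
      rintro y ⟨hy, hys⟩
      obtain ⟨i, -, hi⟩ := exists_mem_dyadic j (h.support_subset hys)
      refine mem_iUnion₂.2 ⟨i, Finset.mem_filter.2 ⟨?_, y, hys, hy, hi⟩, hi⟩
      unfold dyadic at hi
      rw [mem_Ico, div_le_iff₀ h2j, lt_div_iff₀ h2j] at hi
      have hyx := hs hy
      rw [Metric.mem_closedBall, Real.dist_eq, abs_le] at hyx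
      have h₁ : (i : ℝ) < k + 2 := by nlinarith
      have h₂ : (k : ℝ) < i + 2 := by nlinarith
      have h₁' : i < k + 2 := by exact_mod_cast h₁
      have h₂' : k < i + 2 := by exact_mod_cast h₂
      rw [Finset.mem_Icc]
      omega
    have hterm : ∀ i ∈ F, μ.real (dyadic j i) ≤ (2 : ℝ) ^ (-((j : ℝ) * (t - ε / 2))) := by
      intro i hi
      obtain ⟨-, y, hys, hy, hyi⟩ := Finset.mem_filter.1 hi
      refine (hb i y hys hyi).2.trans (Real.rpow_le_rpow_of_exponent_le (by norm_num) ?_)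
      have := hW y (hsW hy) hys
      have hj0 : (0 : ℝ) ≤ j := Nat.cast_nonneg j
      nlinarith
    -- Three is rounded up to a power of two, so that the factor becomes the additive `2` allowed
    -- for in the choice of `r`.
    have hcard : (F.card : ℝ) ≤ 2 ^ (2 : ℝ) := by
      have h1 : F.card ≤ 3 := by
        refine (Finset.card_filter_le _ _).trans ?_
        rw [Nat.card_Icc]
        omega
      have h2 : (F.card : ℝ) ≤ 3 := by exact_mod_cast h1
      norm_num
      linarith
    calc μ.real s = μ.real (s ∩ μ.support) := (measureReal_inter_support μ s).symm
      _ ≤ ∑ i ∈ F, μ.real (dyadic j i) :=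
        (measureReal_mono hcover (measure_ne_top _ _)).trans (measureReal_biUnion_finset_le _ _)
      _ ≤ F.card • (2 : ℝ) ^ (-((j : ℝ) * (t - ε / 2))) := Finset.sum_le_card_nsmul _ _ _ hterm
      _ ≤ 2 ^ (2 : ℝ) * (2 : ℝ) ^ (-((j : ℝ) * (t - ε / 2))) := by
        rw [nsmul_eq_mul]
        gcongr
      _ ≤ r ^ (t - ε) := by
        rw [hrL, ← Real.rpow_mul (by norm_num), ← Real.rpow_add (by norm_num)]
        refine Real.rpow_le_rpow_of_exponent_le (by norm_num) ?_
        have h2 : (L - j) * (t - ε / 2) ≤ |t - ε / 2| := by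
          calc (L - j) * (t - ε / 2) ≤ (L - j) * |t - ε / 2| := by
                gcongr
                exact le_abs_self _
            _ ≤ 1 * |t - ε / 2| := by gcongr; linarith
            _ = _ := one_mul _
        nlinarith
  obtain ⟨r₀, hr₀, hsub⟩ := mem_nhdsGT_iff_exists_Ioo_subset.1 key
  exact ⟨r₀, hr₀, fun x hx r h0 hr s hsW hs => hsub ⟨h0, hr⟩ x hx s hsW hs⟩

theorem tendsto_localDim (h : HasUniformExponent μ A) {x : ℝ} (hx : x ∈ μ.support) :
    Tendsto (fun r : ℝ => Real.log (μ.real (Metric.ball x r)) / Real.log r) (𝓝[>] 0)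
      (𝓝 (A x)) := by
  rw [Metric.tendsto_nhds]
  intro ε hε
  obtain ⟨δ, hδ, hA⟩ := Metric.continuousOn_iff.1 h.continuousOn x hx (ε / 4) (by positivity)
  obtain ⟨r₀, hr₀, hup⟩ := h.exists_measureReal_le_rpow (W := Metric.ball x δ) (t := A x - ε / 4)
    (fun y hy hys => by
      have := hA y hys hy
      rw [Real.dist_eq, abs_lt] at this
      linarith) (ε := ε / 4) (by positivity)
  filter_upwards [h.rpow_le_measureReal_ball hx (half_pos hε),
    Ioo_mem_nhdsGT (lt_min hδ (lt_min hr₀ one_pos))] with r hlow hr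
  obtain ⟨h0, hr⟩ := hr
  rw [lt_min_iff, lt_min_iff] at hr
  have hup := hup x hx r h0 hr.2.1 _ (Metric.ball_subset_ball hr.1.le) Metric.ball_subset_closedBall
  have hlog : Real.log r < 0 := Real.log_neg h0 hr.2.2
  have hpos : 0 < μ.real (Metric.ball x r) := (Real.rpow_pos_of_pos h0 _).trans_le hlow
  have h1 := Real.log_le_log (Real.rpow_pos_of_pos h0 _) hlow
  have h2 := Real.log_le_log hpos hup
  rw [Real.log_rpow h0] at h1 h2
  have h3 : Real.log (μ.real (Metric.ball x r)) / Real.log r ≤ A x + ε / 2 := by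
    rwa [div_le_iff_of_neg hlog]
  have h4 : A x - ε / 4 - ε / 4 ≤ Real.log (μ.real (Metric.ball x r)) / Real.log r := by
    rwa [le_div_iff_of_neg hlog]
  rw [Real.dist_eq, abs_lt]
  constructor <;> linarith

theorem localDim_eq (h : HasUniformExponent μ A) {x : ℝ} (hx : x ∈ μ.support) :
    localDim μ x = (A x : EReal) :=
  ((continuous_coe_real_ereal.tendsto _).comp (h.tendsto_localDim hx)).liminf_eq

theorem exponents_eq (h : HasUniformExponent μ A) :
    exponents μ = (fun x => (A x : EReal)) '' μ.support :=
  image_congr fun _ hx => h.localDim_eq hx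

theorem mem_exponents_iff (h : HasUniformExponent μ A) {α : ℝ} :
    (α : EReal) ∈ exponents μ ↔ α ∈ A '' μ.support := by
  rw [h.exponents_eq]
  simp [EReal.coe_eq_coe_iff]

theorem levelSet_eq (h : HasUniformExponent μ A) (α : ℝ) :
    levelSet μ α = {x ∈ μ.support | A x = α} := by
  ext x
  refine and_congr_right fun hx => ?_
  rw [h.localDim_eq hx, EReal.coe_eq_coe_iff]

end HasUniformExponent
end Multifractal

namespace Multifractal
namespace HasUniformExponent

variable {μ : Measure ℝ} [IsProbabilityMeasure μ] {A : ℝ → ℝ}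

/-! ### Hausdorff dimension -/

/-- Cover by the dyadic intervals of one generation: each diameter to the power `b + ε` is at most
the mass of the interval, so these powers sum to at most `1`. -/
theorem dimH_support_le (h : HasUniformExponent μ A) {b : ℝ} (hb : 0 ≤ b)
    (hA : ∀ x ∈ μ.support, A x ≤ b) : dimH μ.support ≤ ENNReal.ofReal b := by
  classical
  refine ENNReal.le_of_forall_pos_le_add fun ε hε _ => ?_
  have hε' : (0 : ℝ) < ε := hε
  set d : NNReal := b.toNNReal + ε with hd
  have hdb : (d : ℝ) = b + ε := by simp [hd, hb]
  have hd0 : (0 : ℝ) < d := by rw [hdb]; positivity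
  suffices hH : Measure.hausdorffMeasure (d : ℝ) μ.support ≤ 1 by
    refine (dimH_le_of_hausdorffMeasure_ne_top (ne_top_of_le_ne_top ENNReal.one_ne_top hH)).trans ?_
    rw [hd, ENNReal.coe_add]
    rfl
  have hdiam : ∀ (n : ℕ) (i : Fin (2 ^ n)),
      Metric.ediam (dyadic n i ∩ μ.support) ≤ ENNReal.ofReal ((2 ^ n : ℝ)⁻¹) := by
    intro n i
    refine Metric.ediam_le fun x hx y hy => ?_
    rw [edist_dist, Real.dist_eq]
    exact ENNReal.ofReal_le_ofReal (dist_lt_of_mem_dyadic hx.1 hy.1).le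
  have hterm : ∀ᶠ n : ℕ in atTop, ∀ i : Fin (2 ^ n),
      Metric.ediam (dyadic n i ∩ μ.support) ^ (d : ℝ) ≤ μ (dyadic n i) := by
    filter_upwards [h.dyadic_bounds ε hε'] with n hn i
    rcases (dyadic n i ∩ μ.support).eq_empty_or_nonempty with he | ⟨x, hx, hxs⟩
    · rw [he, Metric.ediam_empty, ENNReal.zero_rpow_of_pos hd0]
      exact zero_le
    · calc Metric.ediam (dyadic n i ∩ μ.support) ^ (d : ℝ)
          ≤ ENNReal.ofReal ((2 ^ n : ℝ)⁻¹) ^ (d : ℝ) := by gcongr; exact hdiam n i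
        _ = ENNReal.ofReal ((2 : ℝ) ^ (-((n : ℝ) * d))) := by
          rw [ENNReal.ofReal_rpow_of_nonneg (by positivity) hd0.le, ← Real.rpow_natCast,
            ← Real.rpow_neg (by norm_num), ← Real.rpow_mul (by norm_num), neg_mul]
        _ ≤ ENNReal.ofReal (μ.real (dyadic n i)) := by
          refine ENNReal.ofReal_le_ofReal (le_trans ?_ (hn i x hxs hx).1)
          refine Real.rpow_le_rpow_of_exponent_le (by norm_num) ?_
          have := hA x hxs
          rw [hdb]
          gcongr
        _ = μ (dyadic n i) := by simp [Measure.real]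
  have hr : Tendsto (fun n : ℕ => ENNReal.ofReal ((2 ^ n : ℝ)⁻¹)) atTop (𝓝 0) := by
    rw [← ENNReal.ofReal_zero]
    refine ENNReal.tendsto_ofReal ?_
    simpa [← inv_pow] using
      tendsto_pow_atTop_nhds_zero_of_lt_one (r := (2 : ℝ)⁻¹) (by norm_num) (by norm_num)
  refine (Measure.hausdorffMeasure_le_liminf_sum (d : ℝ) μ.support _ hr
    (fun n (i : Fin (2 ^ n)) => dyadic n i ∩ μ.support) (Eventually.of_forall hdiam)
    (Eventually.of_forall fun n x hx => ?_)).trans ?_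
  · obtain ⟨k, hk, hxk⟩ := exists_mem_dyadic n (h.support_subset hx)
    exact mem_iUnion.2 ⟨⟨k, hk⟩, hxk, hx⟩
  · refine liminf_le_of_frequently_le' (Eventually.frequently ?_)
    filter_upwards [hterm] with n hn
    calc ∑ i : Fin (2 ^ n), Metric.ediam (dyadic n i ∩ μ.support) ^ (d : ℝ)
        ≤ ∑ i : Fin (2 ^ n), μ (dyadic n i) := Finset.sum_le_sum fun i _ => hn i
      _ = μ (⋃ i : Fin (2 ^ n), dyadic n i) := by
        rw [measure_iUnion (fun i j hij => disjoint_dyadic n (fun e => hij (Fin.ext e)))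
          (fun i => measurableSet_dyadic n i), tsum_fintype]
      _ ≤ 1 := prob_le_one

/-- Mass distribution principle, applied to `μ` restricted to a ball where `A` stays close to `A x`.
A set of full measure must charge this ball. -/
theorem le_dimH_of_measure_eq_one (h : HasUniformExponent μ A) {x : ℝ} (hx : x ∈ μ.support)
    {Z : Set ℝ} (hZ : MeasurableSet Z) (hZ1 : μ Z = 1) : ENNReal.ofReal (A x) ≤ dimH Z := by
  refine ENNReal.le_of_forall_nnreal_lt fun d hd => ?_
  have hdA : (d : ℝ) < A x := (ENNReal.lt_ofReal_iff_toReal_lt ENNReal.coe_ne_top).1 hd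
  set ε := (A x - d) / 2 with hε
  have hε0 : 0 < ε := by rw [hε]; linarith
  obtain ⟨δ, hδ, hA⟩ := Metric.continuousOn_iff.1 h.continuousOn x hx ε hε0
  set V := Metric.ball x δ
  have hV : 0 < μ V := (Measure.mem_support_iff_forall x).1 hx _ (Metric.ball_mem_nhds x hδ)
  obtain ⟨r₀, hr₀, hup⟩ := h.exists_measureReal_le_rpow (W := V) (t := A x - ε)
    (fun y hy hys => by
      have := hA y hys hy
      rw [Real.dist_eq, abs_lt] at this
      linarith) hε0
  have hexp : A x - ε - ε = d := by rw [hε]; ring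
  rw [hexp] at hup
  have hle : μ.restrict V ≤ Measure.hausdorffMeasure (d : ℝ) := by
    refine Measure.le_hausdorffMeasure _ _ (ENNReal.ofReal (r₀ / 2)) (by simpa using hr₀) ?_
    intro s hs
    rw [Measure.restrict_apply' measurableSet_ball]
    by_cases hne : μ.real (s ∩ V) = 0
    · rw [Measure.real, ENNReal.toReal_eq_zero_iff] at hne
      rw [hne.resolve_right (measure_ne_top _ _)]
      exact zero_le
    · obtain ⟨y, hys, hy⟩ := exists_mem_support_of_measureReal_ne_zero hne
      have hlt : Metric.ediam s < ENNReal.ofReal r₀ :=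
        hs.trans_lt ((ENNReal.ofReal_lt_ofReal_iff hr₀).2 (half_lt_self hr₀))
      have hnt : Metric.ediam s ≠ ⊤ := hlt.ne_top
      -- The diameter may be zero, whereas the mass bound needs a positive radius; it is used at
      -- radii above the diameter, which then decrease to it.
      have : (𝓝[>] Metric.ediam s).NeBot := nhdsGT_neBot_of_exists_gt ⟨_, hlt⟩
      refine ge_of_tendsto (((ENNReal.continuous_rpow_const (y := (d : ℝ))).tendsto
        (Metric.ediam s)).mono_left (nhdsWithin_le_nhds (s := Ioi (Metric.ediam s)))) ?_
      filter_upwards [Ioo_mem_nhdsGT hlt] with r hr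
      have hrt : r ≠ ⊤ := (hr.2.trans ENNReal.ofReal_lt_top).ne
      have hr0 : r ≠ 0 := (bot_le.trans_lt hr.1).ne'
      have hrpos : 0 < r.toReal := ENNReal.toReal_pos hr0 hrt
      have := hup y hys r.toReal hrpos ((ENNReal.lt_ofReal_iff_toReal_lt hrt).1 hr.2) (s ∩ V)
        inter_subset_right (fun z hz => by
          rw [Metric.mem_closedBall, dist_edist]
          exact ENNReal.toReal_mono hrt
            ((Metric.edist_le_ediam_of_mem hz.1 hy.1).trans hr.1.le))
      rw [← ENNReal.ofReal_toReal (measure_ne_top μ (s ∩ V)), ← ENNReal.ofReal_toReal hrt,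
        ENNReal.ofReal_rpow_of_pos hrpos]
      exact ENNReal.ofReal_le_ofReal this
  refine le_dimH_of_hausdorffMeasure_ne_zero ?_
  have hZV : μ.restrict V Z = μ V := by
    rw [Measure.restrict_apply hZ, inter_comm]
    exact measure_inter_conull ((prob_compl_eq_zero_iff hZ).2 hZ1)
  have := hle Z
  rw [hZV] at this
  exact (hV.trans_le this).ne'

theorem dimMeasure_eq (h : HasUniformExponent μ A) {b : ℝ} (hb : 0 ≤ b)
    (hA : IsGreatest (A '' μ.support) b) : dimMeasure μ = ENNReal.ofReal b := by
  obtain ⟨⟨x, hx, rfl⟩, hmax⟩ := hA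
  refine le_antisymm ?_ (le_iInf₂ fun Z hZ => h.le_dimH_of_measure_eq_one hx hZ.1 hZ.2)
  refine (iInf₂_le μ.support ⟨Measure.isClosed_support.measurableSet, ?_⟩).trans
    (h.dimH_support_le hb fun y hy => hmax ⟨y, hy, rfl⟩)
  exact (prob_compl_eq_zero_iff Measure.isClosed_support.measurableSet).1
    Measure.measure_compl_support

/-! ### Large deviations spectrum -/

/-- The counted intervals are disjoint, each of mass at least `2^(-j(α+ε))`, and their total mass is
at most `1`. -/
theorem dyadicRate_le (μ : Measure ℝ) [IsProbabilityMeasure μ] (α ε : ℝ) :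
    dyadicRate μ α ε ≤ ((α + ε : ℝ) : EReal) := by
  refine liminf_le_of_frequently_le' (Eventually.frequently ?_)
  filter_upwards [eventually_gt_atTop 0] with j hj
  have hj' : (0 : ℝ) < j := by exact_mod_cast hj
  unfold log2
  split_ifs with h0
  · rw [EReal.bot_div_of_pos_ne_top (by exact_mod_cast hj') (EReal.coe_ne_top _)]
    exact bot_le
  · classical
    rw [← EReal.coe_div, EReal.coe_le_coe_iff, div_le_iff₀ hj']
    have hpos : (0 : ℝ) < dyadicCount μ α ε j :=
      lt_of_le_of_ne (Nat.cast_nonneg _) (Ne.symm h0)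
    rw [Real.logb_le_iff_le_rpow (by norm_num) hpos]
    have h1 : (dyadicCount μ α ε j : ℝ) * (2 : ℝ) ^ (-((j : ℝ) * (α + ε))) ≤ 1 := by
      rw [← nsmul_eq_mul]
      exact (Finset.card_nsmul_le_sum _ _ _ fun k hk => (Finset.mem_filter.1 hk).2.1).trans
        (sum_measureReal_dyadic_le_one μ j _)
    rw [Real.rpow_neg (by norm_num), ← div_eq_mul_inv, div_le_one (by positivity)] at h1
    rwa [mul_comm]

theorem tendsto_add_div_atTop (u v : ℝ) :
    Tendsto (fun j : ℕ => u + v / (j : ℝ)) atTop (𝓝 u) := by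
  simpa using tendsto_const_nhds.add (tendsto_const_div_atTop_nhds_zero_nat v)

/-- Intervals of mass at most `2^(-j(A x - ε))` with total mass at least `c` number at least `c
2^(j(A x - ε))`; the constant `c` disappears after division by `j`. -/
theorem le_dyadicRate (h : HasUniformExponent μ A) {x : ℝ} (hx : x ∈ μ.support) {ε : ℝ}
    (hε : 0 < ε) : ((A x - ε : ℝ) : EReal) ≤ dyadicRate μ (A x) ε := by
  obtain ⟨c, hc, hF⟩ := h.exists_mass_le_sum hx hε
  have hlim := (continuous_coe_real_ereal.tendsto _).comp
    (tendsto_add_div_atTop (A x - ε) (Real.logb 2 c))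
  rw [← hlim.liminf_eq]
  refine liminf_le_liminf ?_
  filter_upwards [hF, eventually_gt_atTop 0] with j ⟨F, hFr, hFb, hcF⟩ hj
  have hj' : (0 : ℝ) < j := by exact_mod_cast hj
  have hcard : F.card ≤ dyadicCount μ (A x) ε j :=
    Finset.card_le_card fun k hk => Finset.mem_filter.2 ⟨hFr hk, hFb k hk⟩
  have h1 : c ≤ (dyadicCount μ (A x) ε j : ℝ) * (2 : ℝ) ^ (-((j : ℝ) * (A x - ε))) :=
    calc c ≤ F.card • (2 : ℝ) ^ (-((j : ℝ) * (A x - ε))) :=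
          hcF.trans (Finset.sum_le_card_nsmul _ _ _ fun k hk => (hFb k hk).2)
      _ ≤ _ := by
        rw [nsmul_eq_mul]
        gcongr
  have hpos : (0 : ℝ) < dyadicCount μ (A x) ε j := by
    by_contra! h0
    have : (dyadicCount μ (A x) ε j : ℝ) * (2 : ℝ) ^ (-((j : ℝ) * (A x - ε))) ≤ 0 :=
      mul_nonpos_of_nonpos_of_nonneg h0 (by positivity)
    linarith
  unfold log2
  rw [if_neg hpos.ne', ← EReal.coe_div, Function.comp_apply, EReal.coe_le_coe_iff,
    le_div_iff₀ hj', add_mul, div_mul_cancel₀ _ hj'.ne']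
  have h2 := Real.logb_le_logb_of_le (b := 2) (by norm_num) hc h1
  rw [Real.logb_mul hpos.ne' (by positivity), Real.logb_rpow (by norm_num) (by norm_num)] at h2
  linarith

theorem largeDeviations_eq (h : HasUniformExponent μ A) {x : ℝ} (hx : x ∈ μ.support) :
    largeDeviations μ (A x) = (A x : EReal) := by
  refine tendsto_nhds_unique (tendsto_dyadicRate μ (A x)) ?_
  have hs : Tendsto (fun ε : ℝ => ε) (𝓝[>] 0) (𝓝 0) := tendsto_nhdsWithin_of_tendsto_nhds tendsto_id
  have h1 : Tendsto (fun ε : ℝ => ((A x - ε : ℝ) : EReal)) (𝓝[>] 0) (𝓝 (A x : EReal)) := by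
    refine (continuous_coe_real_ereal.tendsto _).comp ?_
    simpa using tendsto_const_nhds.sub hs
  have h2 : Tendsto (fun ε : ℝ => ((A x + ε : ℝ) : EReal)) (𝓝[>] 0) (𝓝 (A x : EReal)) := by
    refine (continuous_coe_real_ereal.tendsto _).comp ?_
    simpa using tendsto_const_nhds.add hs
  refine tendsto_of_tendsto_of_tendsto_of_le_of_le' h1 h2 ?_
    (Eventually.of_forall fun ε => dyadicRate_le μ (A x) ε)
  filter_upwards [self_mem_nhdsWithin] with ε hε using h.le_dyadicRate hx hε

/-- The image of `A` is compact, so some `δ`-ball around `α` misses it. For large `j` every charged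
interval has exponent within `δ / 2` of a value of `A`, hence none is counted once `ε < δ / 2`. -/
theorem largeDeviations_eq_bot (h : HasUniformExponent μ A) {α : ℝ}
    (hα : α ∉ A '' μ.support) : largeDeviations μ α = ⊥ := by
  have hcl : IsClosed (A '' μ.support) :=
    (h.isCompact_support.image_of_continuousOn h.continuousOn).isClosed
  obtain ⟨δ, hδ, hball⟩ := Metric.isOpen_iff.1 hcl.isOpen_compl α hα
  refine tendsto_nhds_unique (tendsto_dyadicRate μ α) (tendsto_const_nhds.congr' ?_)
  filter_upwards [Ioo_mem_nhdsGT (half_pos hδ)] with ε ⟨hε0, hε⟩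
  symm
  rw [eq_bot_iff]
  refine liminf_le_of_frequently_le' (Eventually.frequently ?_)
  filter_upwards [h.dyadic_bounds (δ / 2) (half_pos hδ), eventually_gt_atTop 0] with j hb hj
  have hj' : (0 : ℝ) < j := by exact_mod_cast hj
  suffices h0 : dyadicCount μ α ε j = 0 by
    unfold log2
    rw [h0, if_pos Nat.cast_zero,
      EReal.bot_div_of_pos_ne_top (by exact_mod_cast hj') (EReal.coe_ne_top _)]
  unfold dyadicCount
  rw [Finset.card_eq_zero, Finset.filter_eq_empty_iff]
  rintro k - ⟨h1, h2⟩
  obtain ⟨x, hx, hxk⟩ := exists_mem_support_of_measureReal_ne_zero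
    (((Real.rpow_pos_of_pos (by norm_num) _).trans_le h1).ne')
  obtain ⟨h3, h4⟩ := hb k x hx hxk
  have h5 := (Real.rpow_le_rpow_left_iff (by norm_num)).1 (h1.trans h4)
  have h6 := (Real.rpow_le_rpow_left_iff (by norm_num)).1 (h3.trans h2)
  rw [neg_le_neg_iff, mul_le_mul_iff_right₀ hj'] at h5 h6
  refine hball (a := A x) ?_ ⟨x, hx, rfl⟩
  rw [Metric.mem_ball, Real.dist_eq, abs_lt]
  constructor <;> linarith

/-! ### Scaling function and Legendre spectrum -/

theorem tendsto_log2_div_neg {S : ℕ → ℝ} {t : ℝ}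
    (hS : ∀ ε > 0, ∃ c > 0, ∀ᶠ j : ℕ in atTop, c * (2 : ℝ) ^ (-((j : ℝ) * (t + ε))) ≤ S j ∧
      S j ≤ (2 : ℝ) ^ (-((j : ℝ) * (t - ε)))) :
    Tendsto (fun j : ℕ => log2 (S j) / ((-(j : ℝ) : ℝ) : EReal)) atTop (𝓝 (t : EReal)) := by
  have hpos : ∀ᶠ j : ℕ in atTop, 0 < S j := by
    obtain ⟨c, hc, hj⟩ := hS 1 one_pos
    filter_upwards [hj] with j hj
    exact lt_of_lt_of_le (by positivity) hj.1
  have hreal : Tendsto (fun j : ℕ => Real.logb 2 (S j) / (-(j : ℝ))) atTop (𝓝 t) := by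
    rw [Metric.tendsto_nhds]
    intro ε hε
    obtain ⟨c, hc, hj⟩ := hS (ε / 2) (half_pos hε)
    have hlim := tendsto_add_div_atTop (t + ε / 2) (-Real.logb 2 c)
    filter_upwards [hj, hpos, eventually_gt_atTop 0,
      hlim.eventually_lt_const (show t + ε / 2 < t + ε by linarith)] with j ⟨h1, h2⟩ hp hj0 hl
    have hj' : (0 : ℝ) < j := by exact_mod_cast hj0
    have h3 := Real.logb_le_logb_of_le (b := 2) (by norm_num) (by positivity) h1
    have h4 := Real.logb_le_logb_of_le (b := 2) (by norm_num) hp h2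
    rw [Real.logb_mul hc.ne' (by positivity), Real.logb_rpow (by norm_num) (by norm_num)] at h3
    rw [Real.logb_rpow (by norm_num) (by norm_num)] at h4
    have h5 : t - ε / 2 ≤ Real.logb 2 (S j) / (-(j : ℝ)) := by
      rw [le_div_iff_of_neg (by linarith)]
      linarith
    have h6 : Real.logb 2 (S j) / (-(j : ℝ)) ≤ t + ε / 2 + -Real.logb 2 c / j := by
      rw [div_le_iff_of_neg (by linarith), add_mul, mul_neg (_ / _), div_mul_cancel₀ _ hj'.ne']
      linarith
    rw [Real.dist_eq, abs_lt]
    constructor <;> linarith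
  refine ((continuous_coe_real_ereal.tendsto _).comp hreal).congr' ?_
  filter_upwards [hpos] with j hj
  unfold log2
  rw [if_neg hj.ne', Function.comp_apply, EReal.coe_div]

/-- The hypothesis says that `e` minimises `A (q - 1)`. The upper bound on the sum uses this
extremal exponent for every interval, the lower bound only the intervals near a point where it is
attained. -/
theorem scalingFunction_eq (h : HasUniformExponent μ A) {q e : ℝ} (he : e ∈ A '' μ.support)
    (hext : ∀ y ∈ μ.support, e * (q - 1) ≤ A y * (q - 1)) :
    scalingFunction μ q = ((e * (q - 1) : ℝ) : EReal) := by
  classical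
  obtain ⟨x, hx, rfl⟩ := he
  refine (tendsto_log2_div_neg fun ε hε => ?_).liminf_eq
  -- An error `η` in the exponent of the mass becomes `η |q - 1| ≤ ε` after raising to the power `q
  -- - 1`; the `+ 1` covers `q = 1`.
  set η := ε / (|q - 1| + 1) with hη
  have hη0 : 0 < η := by positivity
  have hηε : η * |q - 1| ≤ ε := by
    rw [hη, div_mul_eq_mul_div, div_le_iff₀ (by positivity)]
    nlinarith [abs_nonneg (q - 1)]
  have hq := abs_le.1 (show |η * (q - 1)| ≤ ε by rwa [abs_mul, abs_of_pos hη0])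
  have hmass : ∀ {j : ℕ} {u m : ℝ}, (2 : ℝ) ^ (-((j : ℝ) * (u + η))) ≤ m →
      m ≤ (2 : ℝ) ^ (-((j : ℝ) * (u - η))) →
      (2 : ℝ) ^ (-((j : ℝ) * (u * (q - 1) + ε))) ≤ m ^ (q - 1) ∧
        m ^ (q - 1) ≤ (2 : ℝ) ^ (-((j : ℝ) * (u * (q - 1) - ε))) := by
    intro j u m h1 h2
    have hm : 0 < m := (Real.rpow_pos_of_pos (by norm_num) _).trans_le h1
    have hj : (0 : ℝ) ≤ j := Nat.cast_nonneg j
    have h3 := mul_le_mul_of_nonneg_left hq.1 hj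
    have h4 := mul_le_mul_of_nonneg_left hq.2 hj
    rcases le_total 0 (q - 1) with hq0 | hq0
    · have h1' := Real.rpow_le_rpow (by positivity) h1 hq0
      have h2' := Real.rpow_le_rpow hm.le h2 hq0
      rw [← Real.rpow_mul (by norm_num)] at h1' h2'
      exact ⟨le_trans (Real.rpow_le_rpow_of_exponent_le (by norm_num) (by linarith)) h1',
        h2'.trans (Real.rpow_le_rpow_of_exponent_le (by norm_num) (by linarith))⟩
    · have h1' := Real.rpow_le_rpow_of_nonpos (by positivity) h1 hq0
      have h2' := Real.rpow_le_rpow_of_nonpos hm h2 hq0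
      rw [← Real.rpow_mul (by norm_num)] at h1' h2'
      exact ⟨le_trans (Real.rpow_le_rpow_of_exponent_le (by norm_num) (by linarith)) h2',
        h1'.trans (Real.rpow_le_rpow_of_exponent_le (by norm_num) (by linarith))⟩
  have hsplit : ∀ {m : ℝ}, 0 < m → m ^ q = m * m ^ (q - 1) := by
    intro m hm
    rw [Real.rpow_sub_one hm.ne', mul_div_cancel₀ _ hm.ne']
  obtain ⟨c, hc, hF⟩ := h.exists_mass_le_sum hx hη0
  refine ⟨c, hc, ?_⟩
  filter_upwards [hF, h.dyadic_bounds η hη0] with j ⟨F, hFr, hFb, hcF⟩ hb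
  constructor
  · calc c * (2 : ℝ) ^ (-((j : ℝ) * (A x * (q - 1) + ε)))
        ≤ (∑ k ∈ F, μ.real (dyadic j k)) * (2 : ℝ) ^ (-((j : ℝ) * (A x * (q - 1) + ε))) := by
          gcongr
      _ = ∑ k ∈ F, μ.real (dyadic j k) * (2 : ℝ) ^ (-((j : ℝ) * (A x * (q - 1) + ε))) :=
          Finset.sum_mul _ _ _
      _ ≤ ∑ k ∈ F, μ.real (dyadic j k) ^ q := by
          refine Finset.sum_le_sum fun k hk => ?_
          have hm := (Real.rpow_pos_of_pos (by norm_num) _).trans_le (hFb k hk).1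
          rw [hsplit hm]
          exact mul_le_mul_of_nonneg_left (hmass (hFb k hk).1 (hFb k hk).2).1 hm.le
      _ ≤ _ := by
          refine Finset.sum_le_sum_of_subset_of_nonneg (fun k hk => ?_) fun k _ _ => by positivity
          exact Finset.mem_filter.2 ⟨hFr hk,
            ((Real.rpow_pos_of_pos (by norm_num) _).trans_le (hFb k hk).1).ne'⟩
  · calc ∑ k ∈ (Finset.range (2 ^ j)).filter (fun k => μ.real (dyadic j k) ≠ 0),
          μ.real (dyadic j k) ^ q
        ≤ ∑ k ∈ (Finset.range (2 ^ j)).filter (fun k => μ.real (dyadic j k) ≠ 0),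
          μ.real (dyadic j k) * (2 : ℝ) ^ (-((j : ℝ) * (A x * (q - 1) - ε))) := by
          refine Finset.sum_le_sum fun k hk => ?_
          have hne := (Finset.mem_filter.1 hk).2
          have hm : 0 < μ.real (dyadic j k) := lt_of_le_of_ne measureReal_nonneg (Ne.symm hne)
          obtain ⟨y, hy, hyk⟩ := exists_mem_support_of_measureReal_ne_zero hne
          rw [hsplit hm]
          refine mul_le_mul_of_nonneg_left ((hmass (hb k y hy hyk).1 (hb k y hy hyk).2).2.trans ?_)
            hm.le
          refine Real.rpow_le_rpow_of_exponent_le (by norm_num) ?_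
          have := hext y hy
          gcongr
      _ = (∑ k ∈ (Finset.range (2 ^ j)).filter (fun k => μ.real (dyadic j k) ≠ 0),
          μ.real (dyadic j k)) * (2 : ℝ) ^ (-((j : ℝ) * (A x * (q - 1) - ε))) :=
          (Finset.sum_mul _ _ _).symm
      _ ≤ 1 * (2 : ℝ) ^ (-((j : ℝ) * (A x * (q - 1) - ε))) := by
          gcongr
          exact sum_measureReal_dyadic_le_one μ j _
      _ = _ := one_mul _

theorem scalingFunction_of_le_one (h : HasUniformExponent μ A) {b : ℝ}
    (hb : IsGreatest (A '' μ.support) b) {q : ℝ} (hq : q ≤ 1) :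
    scalingFunction μ q = ((b * (q - 1) : ℝ) : EReal) :=
  h.scalingFunction_eq hb.1 fun y hy =>
    mul_le_mul_of_nonpos_right (hb.2 ⟨y, hy, rfl⟩) (by linarith)

theorem scalingFunction_of_one_lt (h : HasUniformExponent μ A) {a : ℝ}
    (ha : IsLeast (A '' μ.support) a) {q : ℝ} (hq : 1 < q) :
    scalingFunction μ q = ((a * (q - 1) : ℝ) : EReal) :=
  h.scalingFunction_eq ha.1 fun y hy =>
    mul_le_mul_of_nonneg_right (ha.2 ⟨y, hy, rfl⟩) (by linarith)

theorem legendreSpectrum_eq (h : HasUniformExponent μ A) {a b : ℝ}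
    (ha : IsLeast (A '' μ.support) a) (hb : IsGreatest (A '' μ.support) b) {α : ℝ}
    (hα : α ∈ Icc a b) : legendreSpectrum μ α = (α : EReal) := by
  refine le_antisymm ?_ (le_iInf fun q => ?_)
  -- The scaling function vanishes at `q = 1`, so this `q` attains the infimum.
  · refine (iInf_le _ 1).trans ?_
    rw [h.scalingFunction_of_le_one hb le_rfl, ← EReal.coe_sub, EReal.coe_le_coe_iff]
    simp
  · rcases le_or_gt q 1 with hq | hq
    · rw [h.scalingFunction_of_le_one hb hq, ← EReal.coe_sub, EReal.coe_le_coe_iff]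
      nlinarith [hα.2]
    · rw [h.scalingFunction_of_one_lt ha hq, ← EReal.coe_sub, EReal.coe_le_coe_iff]
      nlinarith [hα.1]

theorem legendreSpectrum_eq_bot (h : HasUniformExponent μ A) {a b : ℝ}
    (ha : IsLeast (A '' μ.support) a) (hb : IsGreatest (A '' μ.support) b) {α : ℝ}
    (hα : α ∉ Icc a b) : legendreSpectrum μ α = ⊥ := by
  rw [EReal.eq_bot_iff_forall_lt]
  intro y
  rw [mem_Icc, not_and_or, not_le, not_le] at hα
  rcases hα with hα | hα
  -- For `q > 1` the quantity is `a - q (a - α)`; this `q` makes it at most `y - 1`. The other case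
  -- mirrors this with `q` very negative.
  · set q := max 2 ((a - y + 1) / (a - α)) with hq
    have h1 : 1 < q := lt_of_lt_of_le (by norm_num) (le_max_left _ _)
    have h2 : a - y + 1 ≤ q * (a - α) := by
      rw [← div_le_iff₀ (by linarith)]
      exact le_max_right _ _
    refine (iInf_le _ q).trans_lt ?_
    rw [h.scalingFunction_of_one_lt ha h1, ← EReal.coe_sub, EReal.coe_lt_coe_iff]
    linarith
  · set q := min 0 (-((b - y + 1) / (α - b))) with hq
    have h1 : q ≤ 1 := (min_le_left _ _).trans zero_le_one
    have h2 : b - y + 1 ≤ -q * (α - b) := by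
      rw [← div_le_iff₀ (by linarith)]
      linarith [min_le_right 0 (-((b - y + 1) / (α - b)))]
    refine (iInf_le _ q).trans_lt ?_
    rw [h.scalingFunction_of_le_one hb h1, ← EReal.coe_sub, EReal.coe_lt_coe_iff]
    linarith

end HasUniformExponent
end Multifractal

noncomputable section

namespace Multifractal

/-! ### Binary expansions -/

theorem ofDigits_lt_one {d : ℕ → Fin 2} {p : ℕ} (hp : d p = 0) : Real.ofDigits d < 1 := by
  rw [← Real.ofDigits_const_last_eq_one 1]
  unfold Real.ofDigits
  refine Summable.tsum_lt_tsum (i := p) (fun n => ?_) ?_ Real.summable_ofDigitsTerm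
    Real.summable_ofDigitsTerm
  · unfold Real.ofDigitsTerm
    gcongr
    exact Fin.le_last _
  · unfold Real.ofDigitsTerm
    rw [hp]
    simp

theorem exists_two_pow_mul_ofDigits (d : ℕ → Fin 2) (j : ℕ) :
    ∃ m : ℕ, 2 ^ j * Real.ofDigits d = m + Real.ofDigits (fun i => d (i + j)) := by
  induction j with
  | zero => exact ⟨0, by simp⟩
  | succ j ih =>
    obtain ⟨m, hm⟩ := ih
    refine ⟨2 * m + d j, ?_⟩
    have h := Real.ofDigits_eq_sum_add_ofDigits (fun i => d (i + j)) 1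
    have hs : (fun i => d (i + 1 + j)) = fun i => d (i + (j + 1)) := by
      funext i
      congr 1
      ring
    rw [hs] at h
    simp only [Finset.sum_range_one, Real.ofDigitsTerm, Nat.cast_ofNat, zero_add, pow_one] at h
    rw [pow_succ', mul_assoc, hm, h]
    push_cast
    ring

/-- Infinitely many zeros make every tail of the expansion strictly less than `1`, so integer parts
read off the digits. A tail of ones would push the point into the next half-open interval. -/
theorem floor_two_pow_succ_mul_ofDigits {d : ℕ → Fin 2} (hd : ∀ P, ∃ p ≥ P, d p = 0) (j : ℕ) :
    ⌊2 ^ (j + 1) * Real.ofDigits d⌋₊ = 2 * ⌊2 ^ j * Real.ofDigits d⌋₊ + d j := by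
  have hlt : ∀ j, Real.ofDigits (fun i => d (i + j)) < 1 := by
    intro j
    obtain ⟨p, hp, hp0⟩ := hd j
    exact ofDigits_lt_one (p := p - j) (by simpa [Nat.sub_add_cancel hp] using hp0)
  obtain ⟨m, hm⟩ := exists_two_pow_mul_ofDigits d j
  have h := Real.ofDigits_eq_sum_add_ofDigits (fun i => d (i + j)) 1
  have hs : (fun i => d (i + 1 + j)) = fun i => d (i + (j + 1)) := by
    funext i
    congr 1
    ring
  rw [hs] at h
  simp only [Finset.sum_range_one, Real.ofDigitsTerm, Nat.cast_ofNat, zero_add, pow_one] at h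
  have h1 : ⌊2 ^ j * Real.ofDigits d⌋₊ = m := by
    rw [hm, Nat.floor_eq_iff (add_nonneg (Nat.cast_nonneg _) (Real.ofDigits_nonneg _))]
    exact ⟨by linarith [Real.ofDigits_nonneg fun i => d (i + j)], by linarith [hlt j]⟩
  rw [h1, pow_succ', mul_assoc, hm, Nat.floor_eq_iff
    (mul_nonneg zero_le_two (add_nonneg (Nat.cast_nonneg _) (Real.ofDigits_nonneg _))), h]
  push_cast
  constructor
  · linarith [Real.ofDigits_nonneg fun i => d (i + (j + 1))]
  · linarith [hlt (j + 1)]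

theorem floor_two_pow_mul_ofDigits_eq_iff {d e : ℕ → Fin 2} (hd : ∀ P, ∃ p ≥ P, d p = 0)
    (he : ∀ P, ∃ p ≥ P, e p = 0) (j : ℕ) :
    ⌊2 ^ j * Real.ofDigits d⌋₊ = ⌊2 ^ j * Real.ofDigits e⌋₊ ↔ ∀ p < j, d p = e p := by
  induction j with
  | zero =>
    have h (f : ℕ → Fin 2) (hf : ∀ P, ∃ p ≥ P, f p = 0) : ⌊2 ^ 0 * Real.ofDigits f⌋₊ = 0 := by
      obtain ⟨p, -, hp⟩ := hf 0
      rw [Nat.floor_eq_zero]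
      simpa using ofDigits_lt_one hp
    rw [h d hd, h e he]
    simp
  | succ j ih =>
    rw [floor_two_pow_succ_mul_ofDigits hd, floor_two_pow_succ_mul_ofDigits he,
      Nat.forall_lt_succ_right, ← ih, Fin.ext_iff]
    have := (d j).2
    have := (e j).2
    omega

/-! ### Exponents coded by binary sequences -/

/-- The digits in base three, equal to `0` or `2`, of the point of the Cantor set coded by `ω`. -/
def ternaryDigits (ω : ℕ → Bool) : ℕ → Fin 3 := fun i => cond (ω i) 2 0

/-- The exponent coded by `ω`: the image in `[a,b]` of a point of the Cantor set. -/
def codedExponent (a b : ℝ) (ω : ℕ → Bool) : ℝ := a + (b - a) * Real.ofDigits (ternaryDigits ω)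

/-- The largest exponent coded by a sequence that agrees with `ω` in the first `n` places. -/
def upperExponent (a b : ℝ) (n : ℕ) (ω : ℕ → Bool) : ℝ :=
  a + (b - a) * (∑ i ∈ Finset.range n, Real.ofDigitsTerm (ternaryDigits ω) i + (3 ^ n)⁻¹)

/-- The place in the binary expansion that carries the `n`-th bit of `ω`. -/
def position (a b : ℝ) (n : ℕ) (ω : ℕ → Bool) : ℕ := ⌈n / upperExponent a b n ω⌉₊ + Nat.sqrt n

open scoped Classical in
/-- The binary digits of the point coded by `ω`. -/
def codedDigits (a b : ℝ) (ω : ℕ → Bool) (p : ℕ) : Fin 2 :=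
  if ∃ n, position a b n ω = p ∧ ω n = true then 1 else 0

/-- The point of `[0,1)` coded by `ω`. -/
def codedPoint (a b : ℝ) (ω : ℕ → Bool) : ℝ := Real.ofDigits (codedDigits a b ω)

theorem continuous_codedExponent (a b : ℝ) : Continuous (codedExponent a b) := by
  have : Continuous ternaryDigits :=
    continuous_pi fun i => (continuous_of_discreteTopology (f := fun c : Bool =>
      (cond c 2 0 : Fin 3))).comp (continuous_apply i)
  exact continuous_const.add (continuous_const.mul (Real.continuous_ofDigits.comp this))

theorem range_codedExponent (a b : ℝ) :
    range (codedExponent a b) = (fun t => a + (b - a) * t) '' cantorSet := by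
  have : range (fun ω => Real.ofDigits (ternaryDigits ω)) = cantorSet := by
    apply Subset.antisymm
    · rintro _ ⟨ω, rfl⟩
      exact ofDigits_bool_to_fin_three_mem_cantorSet ω
    · intro x hx
      exact ⟨cantorToBinary x, ofDigits_cantorToTernary hx⟩
  rw [← this, ← range_comp]
  rfl

theorem upperExponent_congr (a b : ℝ) {n : ℕ} {ω ω' : ℕ → Bool} (h : ∀ i < n, ω i = ω' i) :
    upperExponent a b n ω = upperExponent a b n ω' := by
  unfold upperExponent
  rw [Finset.sum_congr rfl fun i hi => ?_]
  unfold Real.ofDigitsTerm ternaryDigits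
  rw [h i (Finset.mem_range.1 hi)]

/-- The place of a bit is known once the earlier bits are, which is what makes decoding possible. -/
theorem position_congr (a b : ℝ) {n : ℕ} {ω ω' : ℕ → Bool} (h : ∀ i < n, ω i = ω' i) :
    position a b n ω = position a b n ω' := by
  unfold position
  rw [upperExponent_congr a b h]

theorem injective_codedExponent {a b : ℝ} (hab : a < b) :
    Function.Injective (codedExponent a b) := by
  intro ω ω' h
  have h1 : Real.ofDigits (ternaryDigits ω) = Real.ofDigits (ternaryDigits ω') :=
    mul_left_cancel₀ (sub_pos.2 hab).ne' (add_left_cancel h)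
  have h2 := ofDigits_zero_two_sequence_unique
    (fun n => by unfold ternaryDigits; cases ω n <;> decide)
    (fun n => by unfold ternaryDigits; cases ω' n <;> decide) h1
  funext n
  have h3 := congrFun h2 n
  unfold ternaryDigits at h3
  revert h3
  cases ω n <;> cases ω' n <;> decide

theorem upperExponent_mem_Icc {a b : ℝ} (hab : a < b) (n : ℕ) (ω : ℕ → Bool) :
    upperExponent a b n ω ∈ Icc (codedExponent a b ω) (codedExponent a b ω + (b - a) * (3 ^ n)⁻¹) := by
  have h := Real.ofDigits_eq_sum_add_ofDigits (ternaryDigits ω) n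
  have h0 := Real.ofDigits_nonneg fun i => ternaryDigits ω (i + n)
  have h1 := Real.ofDigits_le_one fun i => ternaryDigits ω (i + n)
  have h3 : (0 : ℝ) < (3 ^ n)⁻¹ := by positivity
  have hba := sub_pos.2 hab
  unfold upperExponent codedExponent
  rw [h]
  push_cast
  constructor
  · rw [add_le_add_iff_left]
    gcongr
    nlinarith
  · rw [add_assoc, ← mul_add, add_le_add_iff_left]
    gcongr
    nlinarith

/-- A ternary digit is at most `2`, and `2 · 3^(-(n+1)) + 3^(-(n+1)) = 3^(-n)`. -/
theorem upperExponent_succ_le {a b : ℝ} (hab : a < b) (n : ℕ) (ω : ℕ → Bool) :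
    upperExponent a b (n + 1) ω ≤ upperExponent a b n ω := by
  have hba := sub_pos.2 hab
  unfold upperExponent
  rw [Finset.sum_range_succ, add_le_add_iff_left]
  refine mul_le_mul_of_nonneg_left ?_ hba.le
  have h := Real.ofDigitsTerm_le (digits := ternaryDigits ω) (n := n)
  have h3 : ((3 : ℝ) ^ n)⁻¹ = 3 * (3 ^ (n + 1))⁻¹ := by
    rw [pow_succ]
    field_simp
  push_cast at h
  rw [h3]
  linarith

theorem upperExponent_le_one {a b : ℝ} (hab : a < b) (hb : b ≤ 1)
    (n : ℕ) (ω : ℕ → Bool) : upperExponent a b n ω ≤ 1 := by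
  induction n with
  | zero =>
    unfold upperExponent
    simpa using hb
  | succ n ih => exact (upperExponent_succ_le hab n ω).trans ih

theorem le_upperExponent {a b : ℝ} (ha : 0 ≤ a) (hab : a < b)
    (n : ℕ) (ω : ℕ → Bool) : (b - a) * (3 ^ n)⁻¹ ≤ upperExponent a b n ω := by
  have hba := sub_pos.2 hab
  unfold upperExponent
  have : 0 ≤ ∑ i ∈ Finset.range n, Real.ofDigitsTerm (ternaryDigits ω) i :=
    Finset.sum_nonneg fun i _ => Real.ofDigitsTerm_nonneg
  nlinarith [mul_nonneg hba.le this]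

theorem upperExponent_pos {a b : ℝ} (ha : 0 ≤ a) (hab : a < b)
    (n : ℕ) (ω : ℕ → Bool) : 0 < upperExponent a b n ω :=
  (mul_pos (sub_pos.2 hab) (by positivity)).trans_le (le_upperExponent ha hab n ω)

/-- The denominators decrease and stay at most `1`, so the quotient grows by at least `1` at each
step. -/
theorem ceil_div_upperExponent_lt {a b : ℝ} (ha : 0 ≤ a) (hab : a < b) (hb : b ≤ 1)
    (n : ℕ) (ω : ℕ → Bool) :
    ⌈n / upperExponent a b n ω⌉₊ < ⌈(n + 1 : ℕ) / upperExponent a b (n + 1) ω⌉₊ := by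
  have h0 := upperExponent_pos ha hab n ω
  have h1 := upperExponent_pos ha hab (n + 1) ω
  have h2 := upperExponent_succ_le hab n ω
  have h3 := upperExponent_le_one hab hb (n + 1) ω
  have h4 : (n : ℝ) / upperExponent a b n ω + 1 ≤ (n + 1 : ℕ) / upperExponent a b (n + 1) ω := by
    push_cast
    rw [add_div]
    gcongr
    exact (one_le_div h1).2 h3
  rw [Nat.lt_iff_add_one_le, ← Nat.ceil_add_one (by positivity)]
  exact Nat.ceil_mono h4

theorem strictMono_position {a b : ℝ} (ha : 0 ≤ a) (hab : a < b) (hb : b ≤ 1)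
    (ω : ℕ → Bool) : StrictMono fun n => position a b n ω :=
  strictMono_nat_of_lt_succ fun n =>
    add_lt_add_of_lt_of_le (ceil_div_upperExponent_lt ha hab hb n ω) (Nat.sqrt_le_sqrt n.le_succ)

theorem le_position {a b : ℝ} (ha : 0 ≤ a) (hab : a < b) (hb : b ≤ 1)
    (n : ℕ) (ω : ℕ → Bool) : n ≤ position a b n ω :=
  (strictMono_position ha hab hb ω).le_apply

theorem codedDigits_position {a b : ℝ} (ha : 0 ≤ a) (hab : a < b) (hb : b ≤ 1)
    (n : ℕ) (ω : ℕ → Bool) :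
    codedDigits a b ω (position a b n ω) = cond (ω n) 1 0 := by
  unfold codedDigits
  cases h : ω n
  · rw [if_neg, cond_false]
    rintro ⟨m, hm, hm'⟩
    rw [(strictMono_position ha hab hb ω).injective hm, h] at hm'
    exact Bool.false_ne_true hm'
  · rw [if_pos ⟨n, rfl, h⟩, cond_true]

theorem exists_codedDigits_eq_zero {a b : ℝ} (ha : 0 ≤ a) (hab : a < b) (hb : b ≤ 1)
    (ω : ℕ → Bool) (P : ℕ) :
    ∃ p ≥ P, codedDigits a b ω p = 0 := by
  -- With `n + 1` a perfect square, `Nat.sqrt` jumps from `n` to `n + 1`, which leaves the place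
  -- right after that of bit `n` unused.
  set n := (P + 1) ^ 2 - 1 with hn
  have hn1 : n + 1 = (P + 1) * (P + 1) := by
    have : 0 < (P + 1) * (P + 1) := by positivity
    rw [hn, pow_two]
    omega
  have hPn : P ≤ n := by nlinarith
  have hs : Nat.sqrt n < Nat.sqrt (n + 1) := by
    rw [hn1, Nat.sqrt_eq, Nat.sqrt_lt]
    omega
  have hgap : position a b n ω + 1 < position a b (n + 1) ω := by
    have := ceil_div_upperExponent_lt ha hab hb n ω
    unfold position
    omega
  have hle := le_position ha hab hb n ω
  refine ⟨position a b n ω + 1, by omega, ?_⟩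
  unfold codedDigits
  rw [if_neg]
  rintro ⟨m, hm, -⟩
  have h1 : n < m := (strictMono_position ha hab hb ω).lt_iff_lt.1 (by omega)
  have h2 := (strictMono_position ha hab hb ω).monotone (show n + 1 ≤ m from h1)
  omega

/-- The number of bits of `ω` carried by the first `j` binary digits. -/
theorem exists_bitCount {a b : ℝ} (ha : 0 ≤ a) (hab : a < b) (hb : b ≤ 1) (j : ℕ) (ω : ℕ → Bool) :
    ∃ N, j ≤ position a b N ω ∧ ∀ n < N, position a b n ω < j := by
  classical
  have hex : ∃ n, j ≤ position a b n ω := ⟨j, le_position ha hab hb j ω⟩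
  exact ⟨Nat.find hex, Nat.find_spec hex, fun n hn => not_le.1 (Nat.find_min hex hn)⟩

/-- Equal digits give equal bits by strong induction: agreement on earlier bits puts the next one at
the same place in both codes. Conversely, bits from `N` on lie at places at least `j` in both. -/
theorem codedDigits_eq_iff {a b : ℝ} (ha : 0 ≤ a) (hab : a < b) (hb : b ≤ 1)
    {j N : ℕ} {ω ω' : ℕ → Bool} (hN : j ≤ position a b N ω)
    (hN' : ∀ n < N, position a b n ω < j) :
    (∀ p < j, codedDigits a b ω p = codedDigits a b ω' p) ↔ ∀ n < N, ω n = ω' n := by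
  constructor
  · intro h n
    induction n using Nat.strong_induction_on with
    | _ n ih =>
      intro hn
      have hpos := position_congr a b fun m hm => ih m hm (hm.trans hn)
      have h1 := h _ (hN' n hn)
      rw [codedDigits_position ha hab hb, hpos, codedDigits_position ha hab hb] at h1
      revert h1
      cases ω n <;> cases ω' n <;> decide
  · intro h p hp
    have hpos : ∀ n ≤ N, position a b n ω = position a b n ω' := fun n hn =>
      position_congr a b fun m hm => h m (hm.trans_le hn)
    unfold codedDigits
    congr 1
    rw [eq_iff_iff]
    refine exists_congr fun n => ?_
    rcases lt_or_ge n N with hn | hn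
    · rw [hpos n hn.le, h n hn]
    · have h1 := (strictMono_position ha hab hb ω).monotone hn
      have h2 := (strictMono_position ha hab hb ω').monotone hn
      have h3 := hpos N le_rfl
      constructor <;> rintro ⟨h, -⟩ <;> omega

theorem codedPoint_mem_dyadic_iff {a b : ℝ} (ha : 0 ≤ a) (hab : a < b) (hb : b ≤ 1)
    {j k N : ℕ} {ω ω' : ℕ → Bool} (hN : j ≤ position a b N ω)
    (hN' : ∀ n < N, position a b n ω < j) (hω : codedPoint a b ω ∈ dyadic j k) :
    codedPoint a b ω' ∈ dyadic j k ↔ ω' ∈ PiNat.cylinder ω N := by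
  rw [mem_dyadic_iff] at hω ⊢
  rw [← hω.2, eq_comm (b := ⌊_⌋₊)]
  unfold codedPoint
  rw [floor_two_pow_mul_ofDigits_eq_iff (exists_codedDigits_eq_zero ha hab hb ω)
    (exists_codedDigits_eq_zero ha hab hb ω'), codedDigits_eq_iff ha hab hb hN hN']
  simp only [Real.ofDigits_nonneg, true_and, PiNat.mem_cylinder_iff]
  exact forall₂_congr fun n _ => eq_comm

theorem codedPoint_mem_Ico {a b : ℝ} (ha : 0 ≤ a) (hab : a < b) (hb : b ≤ 1)
    (ω : ℕ → Bool) : codedPoint a b ω ∈ Ico (0 : ℝ) 1 := by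
  obtain ⟨p, -, hp⟩ := exists_codedDigits_eq_zero ha hab hb ω 0
  exact ⟨Real.ofDigits_nonneg _, ofDigits_lt_one hp⟩

theorem injective_codedPoint {a b : ℝ} (ha : 0 ≤ a) (hab : a < b) (hb : b ≤ 1)
    : Function.Injective (codedPoint a b) := by
  intro ω ω' h
  funext n
  obtain ⟨N, hN, hN'⟩ := exists_bitCount ha hab hb (position a b n ω + 1) ω
  have hnN : n < N := (strictMono_position ha hab hb ω).lt_iff_lt.1 (by omega)
  refine (codedDigits_eq_iff ha hab hb hN hN').1 ?_ n hnN
  refine (floor_two_pow_mul_ofDigits_eq_iff (exists_codedDigits_eq_zero ha hab hb ω)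
    (exists_codedDigits_eq_zero ha hab hb ω') _).1 ?_
  unfold codedPoint at h
  rw [h]

theorem continuous_codedPoint {a b : ℝ} (ha : 0 ≤ a) (hab : a < b) (hb : b ≤ 1)
    : Continuous (codedPoint a b) := by
  rw [continuous_iff_continuousAt]
  intro ω
  rw [ContinuousAt, Metric.tendsto_nhds]
  intro ε hε
  obtain ⟨j, hj⟩ := exists_pow_lt_of_lt_one hε (show (2 : ℝ)⁻¹ < 1 by norm_num)
  obtain ⟨N, hN, hN'⟩ := exists_bitCount ha hab hb j ω
  filter_upwards [(PiNat.isOpen_cylinder _ ω N).mem_nhds (PiNat.self_mem_cylinder ω N)] with ω' hω'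
  rw [dist_comm, Real.dist_eq]
  refine (Real.abs_ofDigits_sub_ofDigits_le (n := j) ?_).trans_lt (by simpa using hj)
  exact (codedDigits_eq_iff ha hab hb hN hN').2 fun n hn => (PiNat.mem_cylinder_iff.1 hω' n hn).symm

/-! ### Asymptotics of the number of bits -/

/-- Bit `N - 1` still lies before place `j`, which bounds `(N - 1) / u` by `j`, where `u` exceeds
the exponent by at most `(b - a) 3^(-(N-1))`. -/
theorem bitCount_le {a b : ℝ} (ha : 0 ≤ a) (hab : a < b)
    {j N : ℕ} {ω : ℕ → Bool} (hN' : ∀ n < N, position a b n ω < j) :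
    (N : ℝ) ≤ 1 + (codedExponent a b ω + (b - a) * (3 ^ (N - 1))⁻¹) * j := by
  have hba := sub_pos.2 hab
  rcases Nat.eq_zero_or_pos N with rfl | hpos
  · have h1 := upperExponent_mem_Icc hab 0 ω
    have h2 := upperExponent_pos ha hab 0 ω
    have h3 : 0 ≤ codedExponent a b ω + (b - a) * (3 ^ (0 - 1))⁻¹ := h2.le.trans h1.2
    have := mul_nonneg h3 (Nat.cast_nonneg (α := ℝ) j)
    push_cast
    linarith
  · have h1 := upperExponent_mem_Icc hab (N - 1) ω
    have h2 := upperExponent_pos ha hab (N - 1) ω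
    have h3 := hN' (N - 1) (by omega)
    have h4 : ((N - 1 : ℕ) : ℝ) / upperExponent a b (N - 1) ω ≤ j := by
      refine (Nat.le_ceil _).trans ?_
      unfold position at h3
      exact_mod_cast (by omega :
        ⌈((N - 1 : ℕ) : ℝ) / upperExponent a b (N - 1) ω⌉₊ ≤ j)
    rw [div_le_iff₀ h2, Nat.cast_sub hpos] at h4
    have h5 := mul_le_mul_of_nonneg_right h1.2 (Nat.cast_nonneg (α := ℝ) j)
    push_cast at h4
    linarith

/-- Bit `N` lies at place `j` or later, so `j ≤ N / u + 1 + √N`. Multiply by `u ≤ 1` and use `N ≤ j`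
in the root. -/
theorem le_bitCount {a b : ℝ} (ha : 0 ≤ a) (hab : a < b) (hb : b ≤ 1)
    {j N : ℕ} {ω : ℕ → Bool} (hN : j ≤ position a b N ω)
    (hN' : ∀ n < N, position a b n ω < j) :
    codedExponent a b ω * j - 1 - √j ≤ N := by
  have h1 := upperExponent_mem_Icc hab N ω
  have h2 := upperExponent_pos ha hab N ω
  have h3 := upperExponent_le_one hab hb N ω
  have hNj : N ≤ j := by
    rcases Nat.eq_zero_or_pos N with rfl | hpos
    · exact Nat.zero_le _
    · have := hN' (N - 1) (by omega)
      have := le_position ha hab hb (N - 1) ω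
      omega
  have h4 : (Nat.sqrt N : ℝ) ≤ √j :=
    Real.nat_sqrt_le_real_sqrt.trans (Real.sqrt_le_sqrt (by exact_mod_cast hNj))
  have h5 : (j : ℝ) ≤ N / upperExponent a b N ω + 1 + √j := by
    have h6 : (j : ℝ) ≤ (⌈(N : ℝ) / upperExponent a b N ω⌉₊ : ℝ) + (Nat.sqrt N : ℝ) := by
      exact_mod_cast hN
    have h7 := (Nat.ceil_lt_add_one (a := (N : ℝ) / upperExponent a b N ω) (by positivity)).le
    linarith
  have h8 : upperExponent a b N ω * j ≤ N + 1 + √j := by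
    calc upperExponent a b N ω * j
        ≤ upperExponent a b N ω * (N / upperExponent a b N ω + 1 + √j) := by gcongr
      _ = N + upperExponent a b N ω * (1 + √j) := by field_simp; ring
      _ ≤ N + 1 * (1 + √j) := by gcongr
      _ = _ := by ring
  have h9 := mul_le_mul_of_nonneg_right h1.1 (Nat.cast_nonneg (α := ℝ) j)
  linarith

/-- If `N < M`, then `u` is at least `(b - a) 3^(-M)`, so the place of bit `N` is bounded
independently of `ω`. This uniformity is needed where the exponent is near `0`. -/
theorem bitCount_large {a b : ℝ} (ha : 0 ≤ a) (hab : a < b)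
    (M : ℕ) : ∀ᶠ j : ℕ in atTop, ∀ (ω : ℕ → Bool) (N : ℕ),
    j ≤ position a b N ω → M ≤ N := by
  have hba := sub_pos.2 hab
  filter_upwards [eventually_gt_atTop (⌈(M : ℝ) / ((b - a) * (3 ^ M)⁻¹)⌉₊ + M)] with j hj ω N hN
  by_contra! hNM
  have h1 : ⌈(N : ℝ) / upperExponent a b N ω⌉₊ ≤ ⌈(M : ℝ) / ((b - a) * (3 ^ M)⁻¹)⌉₊ := by
    refine Nat.ceil_mono ?_
    have h2 := le_upperExponent ha hab N ω
    have h3 : (b - a) * ((3 : ℝ) ^ M)⁻¹ ≤ (b - a) * (3 ^ N)⁻¹ := by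
      gcongr
      norm_num
    gcongr
    exact h3.trans h2
  have h4 := Nat.sqrt_le_self N
  unfold position at hN
  omega

theorem bitCount_asymptotics {a b : ℝ} (ha : 0 ≤ a) (hab : a < b) (hb : b ≤ 1)
    {ε : ℝ} (hε : 0 < ε) : ∀ᶠ j : ℕ in atTop, ∀ (ω : ℕ → Bool) (N : ℕ),
    j ≤ position a b N ω → (∀ n < N, position a b n ω < j) →
      (j : ℝ) * (codedExponent a b ω - ε) ≤ N ∧ (N : ℝ) ≤ j * (codedExponent a b ω + ε) := by
  have hba := sub_pos.2 hab
  obtain ⟨M, hM⟩ := exists_pow_lt_of_lt_one (half_pos hε) (show (3 : ℝ)⁻¹ < 1 by norm_num)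
  have hsqrt : Tendsto (fun j : ℕ => √(j : ℝ)) atTop atTop :=
    Real.tendsto_sqrt_atTop.comp tendsto_natCast_atTop_atTop
  -- The first condition makes the ternary error at most `ε / 2`; the second gives `1 + √j ≤ 2√j ≤ j
  -- ε`.
  filter_upwards [bitCount_large ha hab (M + 1), hsqrt.eventually_ge_atTop (max 1 (2 / ε))]
    with j hj hs ω N hN hN'
  have hs1 : 1 ≤ √(j : ℝ) := (le_max_left _ _).trans hs
  have hs2 : 2 ≤ √(j : ℝ) * ε := by
    rw [← div_le_iff₀ hε]
    exact (le_max_right _ _).trans hs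
  have hsq : √(j : ℝ) * √(j : ℝ) = j := Real.mul_self_sqrt (Nat.cast_nonneg j)
  have hMN := hj ω N hN
  have h1 := bitCount_le ha hab hN'
  have h2 := le_bitCount ha hab hb hN hN'
  have h3 : (b - a) * ((3 : ℝ) ^ (N - 1))⁻¹ ≤ ε / 2 := by
    have h4 : ((3 : ℝ) ^ (N - 1))⁻¹ ≤ (3 ^ M)⁻¹ := by
      gcongr
      · norm_num
      · omega
    rw [inv_pow] at hM
    have h5 : (0 : ℝ) < (3 ^ (N - 1))⁻¹ := by positivity
    nlinarith
  have h6 := mul_le_mul_of_nonneg_right h3 (Nat.cast_nonneg (α := ℝ) j)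
  have h7 : 2 * √(j : ℝ) ≤ j * ε := by nlinarith
  constructor <;> nlinarith

end Multifractal
end

noncomputable section

namespace Multifractal

/-! ### The measure -/

/-- The law of a sequence of independent fair coin tosses. -/
def coinMeasure : Measure (ℕ → Bool) :=
  Measure.infinitePi fun _ => (PMF.uniformOfFintype Bool).toMeasure

instance : IsProbabilityMeasure coinMeasure := by
  unfold coinMeasure
  infer_instance

theorem coinMeasure_cylinder (ω : ℕ → Bool) (N : ℕ) :
    coinMeasure (PiNat.cylinder ω N) = (2 ^ N)⁻¹ := by
  have h : PiNat.cylinder ω N = Set.pi (Finset.range N) fun i => {ω i} := by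
    ext ω'
    simp [PiNat.mem_cylinder_iff]
  have h1 (c : Bool) : (PMF.uniformOfFintype Bool).toMeasure {c} = 2⁻¹ := by
    rw [PMF.toMeasure_apply_singleton _ _ (measurableSet_singleton c)]
    simp
  rw [h, coinMeasure, Measure.infinitePi_pi _ fun i _ => measurableSet_singleton _]
  simp only [h1, Finset.prod_const, Finset.card_range, ENNReal.inv_pow]

/-- The law of the point coded by a sequence of coin tosses. -/
def codedMeasure (a b : ℝ) : Measure ℝ := coinMeasure.map (codedPoint a b)

/-- The exponent at a point, read off its code. -/
def exponentAt (a b : ℝ) (x : ℝ) : ℝ := codedExponent a b (Function.invFun (codedPoint a b) x)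

theorem exponentAt_codedPoint {a b : ℝ} (ha : 0 ≤ a) (hab : a < b) (hb : b ≤ 1) (ω : ℕ → Bool) :
    exponentAt a b (codedPoint a b ω) = codedExponent a b ω := by
  unfold exponentAt
  rw [Function.leftInverse_invFun (injective_codedPoint ha hab hb)]

theorem isProbabilityMeasure_codedMeasure {a b : ℝ} (ha : 0 ≤ a) (hab : a < b) (hb : b ≤ 1) :
    IsProbabilityMeasure (codedMeasure a b) :=
  Measure.isProbabilityMeasure_map (continuous_codedPoint ha hab hb).measurable.aemeasurable

theorem support_codedMeasure {a b : ℝ} (ha : 0 ≤ a) (hab : a < b) (hb : b ≤ 1) :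
    (codedMeasure a b).support = range (codedPoint a b) := by
  have hc := continuous_codedPoint ha hab hb
  have hcl : IsClosed (range (codedPoint a b)) := (isCompact_range hc).isClosed
  apply Subset.antisymm
  · refine Measure.support_subset_of_isClosed hcl ?_
    rw [mem_ae_iff, codedMeasure, Measure.map_apply hc.measurable hcl.measurableSet.compl]
    simp
  · rintro _ ⟨ω, rfl⟩
    rw [Measure.support_eq_forall_isOpen]
    intro U hωU hU
    rw [codedMeasure, Measure.map_apply hc.measurable hU.measurableSet]
    obtain ⟨_, ⟨ω', N, rfl⟩, -, hsub⟩ :=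
      (PiNat.isTopologicalBasis_cylinders fun _ : ℕ => Bool).exists_subset_of_mem_open
        (show ω ∈ codedPoint a b ⁻¹' U from hωU) (hU.preimage hc)
    refine lt_of_lt_of_le ?_ (measure_mono hsub)
    rw [coinMeasure_cylinder]
    simp

theorem codedMeasure_dyadic {a b : ℝ} (ha : 0 ≤ a) (hab : a < b) (hb : b ≤ 1) {j k N : ℕ}
    {ω : ℕ → Bool} (hN : j ≤ position a b N ω) (hN' : ∀ n < N, position a b n ω < j)
    (hω : codedPoint a b ω ∈ dyadic j k) :
    (codedMeasure a b).real (dyadic j k) = (2 : ℝ) ^ (-(N : ℝ)) := by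
  have h : codedPoint a b ⁻¹' dyadic j k = PiNat.cylinder ω N := by
    ext ω'
    exact codedPoint_mem_dyadic_iff ha hab hb hN hN' hω
  rw [Measure.real, codedMeasure, Measure.map_apply (continuous_codedPoint ha hab hb).measurable
    (measurableSet_dyadic j k), h, coinMeasure_cylinder, Real.rpow_neg (by norm_num),
    Real.rpow_natCast]
  simp

/-- The coding is a closed embedding, as a continuous injection of a compact space, so reading the
code back is continuous on its range. -/
theorem continuousOn_exponentAt {a b : ℝ} (ha : 0 ≤ a) (hab : a < b) (hb : b ≤ 1) :
    ContinuousOn (exponentAt a b) (range (codedPoint a b)) := by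
  have hemb := (continuous_codedPoint ha hab hb).isClosedEmbedding (injective_codedPoint ha hab hb)
  rw [continuousOn_iff_isClosed]
  intro C hC
  refine ⟨codedPoint a b '' (codedExponent a b ⁻¹' C),
    hemb.isClosedMap _ (hC.preimage (continuous_codedExponent a b)), ?_⟩
  ext x
  constructor
  · rintro ⟨hx, ω, rfl⟩
    rw [mem_preimage, exponentAt_codedPoint ha hab hb] at hx
    exact ⟨⟨ω, hx, rfl⟩, ω, rfl⟩
  · rintro ⟨⟨ω, hω, rfl⟩, -⟩
    refine ⟨?_, ω, rfl⟩
    rw [mem_preimage, exponentAt_codedPoint ha hab hb]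
    exact hω

theorem hasUniformExponent_codedMeasure {a b : ℝ} (ha : 0 ≤ a) (hab : a < b) (hb : b ≤ 1) :
    HasUniformExponent (codedMeasure a b) (exponentAt a b) where
  isCompact_support := by
    rw [support_codedMeasure ha hab hb]
    exact isCompact_range (continuous_codedPoint ha hab hb)
  support_subset := by
    rw [support_codedMeasure ha hab hb]
    rintro _ ⟨ω, rfl⟩
    exact codedPoint_mem_Ico ha hab hb ω
  continuousOn := by
    rw [support_codedMeasure ha hab hb]
    exact continuousOn_exponentAt ha hab hb
  dyadic_bounds := by
    intro ε hε
    filter_upwards [bitCount_asymptotics ha hab hb hε] with j hj k x hx hxk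
    rw [support_codedMeasure ha hab hb] at hx
    obtain ⟨ω, rfl⟩ := hx
    obtain ⟨N, hN, hN'⟩ := exists_bitCount ha hab hb j ω
    obtain ⟨h1, h2⟩ := hj ω N hN hN'
    rw [codedMeasure_dyadic ha hab hb hN hN' hxk, exponentAt_codedPoint ha hab hb]
    constructor <;> exact Real.rpow_le_rpow_of_exponent_le (by norm_num) (by linarith)

/-- Only one sequence codes a given point, and it lies in cylinders of mass `2^(-N)`. The absence of
atoms rules out isolated points of the support. -/
theorem codedMeasure_singleton {a b : ℝ} (ha : 0 ≤ a) (hab : a < b) (hb : b ≤ 1) (x : ℝ) :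
    codedMeasure a b {x} = 0 := by
  have := isProbabilityMeasure_codedMeasure ha hab hb
  by_contra h
  have hreal : (codedMeasure a b).real {x} ≠ 0 := by
    rw [Measure.real, ENNReal.toReal_ne_zero]
    exact ⟨h, measure_ne_top _ _⟩
  obtain ⟨_, hx, rfl⟩ := exists_mem_support_of_measureReal_ne_zero hreal
  rw [support_codedMeasure ha hab hb] at hx
  obtain ⟨ω, rfl⟩ := hx
  have hlim : Tendsto (fun N : ℕ => ((2 : ENNReal) ^ N)⁻¹) atTop (𝓝 0) := by
    simp_rw [ENNReal.inv_pow]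
    exact ENNReal.tendsto_pow_atTop_nhds_zero_of_lt_one (by simp)
  refine h (le_antisymm (ge_of_tendsto' hlim fun N => ?_) zero_le)
  rw [codedMeasure, Measure.map_apply (continuous_codedPoint ha hab hb).measurable
    (measurableSet_singleton _), ← coinMeasure_cylinder ω N]
  refine measure_mono fun ω' hω' => ?_
  rw [injective_codedPoint ha hab hb hω']
  exact PiNat.self_mem_cylinder ω N

theorem isCantorSet_support_codedMeasure {a b : ℝ} (ha : 0 ≤ a) (hab : a < b) (hb : b ≤ 1) :
    IsCantorSet (codedMeasure a b).support := by
  have hemb := (continuous_codedPoint ha hab hb).isClosedEmbedding (injective_codedPoint ha hab hb)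
  have hsupp := support_codedMeasure ha hab hb
  refine ⟨?_, (hasUniformExponent_codedMeasure ha hab hb).isCompact_support,
    ⟨Measure.isClosed_support, ?_⟩, ?_⟩
  · rw [hsupp]
    exact range_nonempty _
  · intro x hx
    rw [accPt_iff_nhds]
    intro U hU
    by_contra! hne
    have h0 : U ∩ (codedMeasure a b).support ⊆ {x} := fun y hy => hne y hy
    have h1 := (Measure.mem_support_iff_forall x).1 hx U hU
    rw [← measure_inter_conull (t := (codedMeasure a b).support)
      Measure.measure_compl_support] at h1
    exact (h1.trans_le (measure_mono h0)).ne' (codedMeasure_singleton ha hab hb x)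
  · rw [hsupp, ← image_univ]
    exact hemb.isEmbedding.isTotallyDisconnected_image.2
      (isTotallyDisconnected_of_totallyDisconnectedSpace _)

theorem image_exponentAt {a b : ℝ} (ha : 0 ≤ a) (hab : a < b) (hb : b ≤ 1) :
    exponentAt a b '' (codedMeasure a b).support = (fun t => a + (b - a) * t) '' cantorSet := by
  rw [support_codedMeasure ha hab hb, ← range_comp, ← range_codedExponent]
  congr 1
  funext ω
  exact exponentAt_codedPoint ha hab hb ω

theorem one_mem_cantorSet : (1 : ℝ) ∈ cantorSet := by
  have h : (1 : ℝ) = Real.ofDigits fun _ : ℕ => (2 : Fin 3) :=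
    (Real.ofDigits_const_last_eq_one 2).symm
  rw [h]
  exact ofDigits_zero_two_sequence_mem_cantorSet fun _ => by decide

theorem half_notMem_cantorSet : (1 / 2 : ℝ) ∉ cantorSet := by
  rw [cantorSet_eq_union_halves]
  rintro (⟨x, hx, h⟩ | ⟨x, hx, h⟩)
  · have := (cantorSet_subset_unitInterval hx).2
    simp only at h
    linarith
  · have := (cantorSet_subset_unitInterval hx).1
    simp only at h
    linarith

end Multifractal
end

/-! ### Assembly of the theorem. -/

theorem theorem2 (a b : ℝ) (ha : 0 ≤ a) (hab : a < b) (hb : b ≤ 1) :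
    ∃ (K : Set ℝ) (μ : Measure ℝ),
      -- `μ` is a probability measure whose support is a Cantor set `K ⊆ [0,1]`
      Multifractal.IsCantorSet K ∧ K ⊆ Icc 0 1 ∧ IsProbabilityMeasure μ ∧ μ.support = K ∧
      -- non-empty relatively open subsets of `K` have positive mass
      (∀ U : Set ℝ, IsOpen U → (U ∩ K).Nonempty → 0 < μ (U ∩ K)) ∧
      -- the dimension of `μ` is `b`
      Multifractal.dimMeasure μ = ENNReal.ofReal b ∧
      -- the set `S` of exponents has minimum `a` and maximum `b`
      IsLeast (Multifractal.exponents μ) (a : EReal) ∧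
      IsGreatest (Multifractal.exponents μ) (b : EReal) ∧
      -- `S` is an affine copy of the middle-third Cantor set
      Multifractal.exponents μ = (fun t : ℝ => ((a + (b - a) * t : ℝ) : EReal)) '' cantorSet ∧
      -- each level set has at most one point
      (∀ α : ℝ, 0 ≤ α → (Multifractal.levelSet μ α).Subsingleton) ∧
      -- the multifractal spectrum
      (∀ α : ℝ, (α : EReal) ∈ Multifractal.exponents μ →
        Multifractal.multifractalSpectrum μ α = 0) ∧
      (∀ α ∈ Icc a b, (α : EReal) ∉ Multifractal.exponents μ →
        Multifractal.multifractalSpectrum μ α = ⊥) ∧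
      -- the large deviations spectrum
      (∀ α : ℝ, (α : EReal) ∈ Multifractal.exponents μ →
        Multifractal.largeDeviations μ α = (α : EReal)) ∧
      (∀ α : ℝ, 0 ≤ α → (α : EReal) ∉ Multifractal.exponents μ →
        Multifractal.largeDeviations μ α = ⊥) ∧
      -- the Legendre spectrum
      (∀ α ∈ Icc a b, Multifractal.legendreSpectrum μ α = (α : EReal)) ∧
      (∀ α : ℝ, 0 ≤ α → α ∉ Icc a b → Multifractal.legendreSpectrum μ α = ⊥) ∧
      -- the scaling function
      (∀ q : ℝ, q ≤ 1 → Multifractal.scalingFunction μ q = ((b * (q - 1) : ℝ) : EReal)) ∧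
      (∀ q : ℝ, 1 < q → Multifractal.scalingFunction μ q = ((a * (q - 1) : ℝ) : EReal)) ∧
      -- the three spectra are pairwise different, and the multifractal formalism fails at every
      -- positive exponent of `[a,b]`
      (∃ α ∈ Icc a b,
        Multifractal.multifractalSpectrum μ α ≠ Multifractal.largeDeviations μ α) ∧
      (∃ α ∈ Icc a b,
        Multifractal.largeDeviations μ α ≠ Multifractal.legendreSpectrum μ α) ∧
      (∀ α ∈ Icc a b, 0 < α →
        Multifractal.multifractalSpectrum μ α ≠ Multifractal.legendreSpectrum μ α) := by
  have hprob := Multifractal.isProbabilityMeasure_codedMeasure ha hab hb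
  have h := Multifractal.hasUniformExponent_codedMeasure ha hab hb
  have hba : 0 < b - a := sub_pos.2 hab
  have himg := Multifractal.image_exponentAt ha hab hb
  have hleast : IsLeast (Multifractal.exponentAt a b '' (Multifractal.codedMeasure a b).support) a := by
    rw [himg]
    refine ⟨⟨0, zero_mem_cantorSet, by simp⟩, ?_⟩
    rintro _ ⟨t, ht, rfl⟩
    have := (cantorSet_subset_unitInterval ht).1
    simp only
    nlinarith
  have hgreatest : IsGreatest
      (Multifractal.exponentAt a b '' (Multifractal.codedMeasure a b).support) b := by
    rw [himg]
    refine ⟨⟨1, Multifractal.one_mem_cantorSet, by simp⟩, ?_⟩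
    rintro _ ⟨t, ht, rfl⟩
    have := (cantorSet_subset_unitInterval ht).2
    simp only
    nlinarith
  have hexp : Multifractal.exponents (Multifractal.codedMeasure a b) =
      (fun x : ℝ => (x : EReal)) ''
        (Multifractal.exponentAt a b '' (Multifractal.codedMeasure a b).support) := by
    rw [h.exponents_eq, image_image]
  have hmono : Monotone fun x : ℝ => (x : EReal) := EReal.coe_strictMono.monotone
  have hsub : ∀ α : ℝ, (Multifractal.levelSet (Multifractal.codedMeasure a b) α).Subsingleton := by
    intro α x hx y hy
    rw [h.levelSet_eq, Multifractal.support_codedMeasure ha hab hb] at hx hy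
    obtain ⟨⟨ω, rfl⟩, hx⟩ := hx
    obtain ⟨⟨ω', rfl⟩, hy⟩ := hy
    rw [Multifractal.exponentAt_codedPoint ha hab hb] at hx hy
    rw [Multifractal.injective_codedExponent hab (hx.trans hy.symm)]
  have hspec : ∀ α : ℝ, (α : EReal) ∈ Multifractal.exponents (Multifractal.codedMeasure a b) →
      Multifractal.multifractalSpectrum (Multifractal.codedMeasure a b) α = 0 := by
    rintro α ⟨x, hx, hxα⟩
    have hne : (Multifractal.levelSet (Multifractal.codedMeasure a b) α).Nonempty := ⟨x, hx, hxα⟩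
    unfold Multifractal.multifractalSpectrum
    rw [if_neg hne.ne_empty, dimH_subsingleton (hsub α)]
    rfl
  have hspec' : ∀ α : ℝ, (α : EReal) ∉ Multifractal.exponents (Multifractal.codedMeasure a b) →
      Multifractal.multifractalSpectrum (Multifractal.codedMeasure a b) α = ⊥ := by
    intro α hα
    unfold Multifractal.multifractalSpectrum
    exact if_pos (eq_empty_iff_forall_notMem.2 fun x hx => hα ⟨x, hx.1, hx.2⟩)
  have hLD : ∀ α : ℝ, (α : EReal) ∈ Multifractal.exponents (Multifractal.codedMeasure a b) →
      Multifractal.largeDeviations (Multifractal.codedMeasure a b) α = (α : EReal) := by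
    intro α hα
    obtain ⟨x, hx, rfl⟩ := h.mem_exponents_iff.1 hα
    exact h.largeDeviations_eq hx
  have hLD' : ∀ α : ℝ, (α : EReal) ∉ Multifractal.exponents (Multifractal.codedMeasure a b) →
      Multifractal.largeDeviations (Multifractal.codedMeasure a b) α = ⊥ := fun α hα =>
    h.largeDeviations_eq_bot fun hα' => hα (h.mem_exponents_iff.2 hα')
  have hLeg : ∀ α ∈ Icc a b,
      Multifractal.legendreSpectrum (Multifractal.codedMeasure a b) α = (α : EReal) :=
    fun α hα => h.legendreSpectrum_eq hleast hgreatest hα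
  have hbexp : (b : EReal) ∈ Multifractal.exponents (Multifractal.codedMeasure a b) :=
    h.mem_exponents_iff.2 hgreatest.1
  -- The midpoint of `[a,b]` falls in the central gap of the Cantor set; there the large deviations
  -- spectrum is `-∞` and the Legendre spectrum is finite.
  have hmid : ((a + (b - a) * (1 / 2) : ℝ) : EReal) ∉
      Multifractal.exponents (Multifractal.codedMeasure a b) := by
    rw [h.mem_exponents_iff, himg]
    rintro ⟨t, ht, hte⟩
    have : t = 1 / 2 := mul_left_cancel₀ hba.ne' (add_left_cancel hte)
    exact Multifractal.half_notMem_cantorSet (this ▸ ht)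
  have hmid' : a + (b - a) * (1 / 2) ∈ Icc a b := by
    constructor <;> linarith
  refine ⟨(Multifractal.codedMeasure a b).support, Multifractal.codedMeasure a b,
    Multifractal.isCantorSet_support_codedMeasure ha hab hb,
    h.support_subset.trans Ico_subset_Icc_self, hprob, rfl, ?_, h.dimMeasure_eq (ha.trans hab.le) hgreatest, ?_, ?_, ?_, fun α _ => hsub α, hspec,
    fun α _ => hspec' α, hLD, fun α _ => hLD' α, hLeg,
    fun α _ hα => h.legendreSpectrum_eq_bot hleast hgreatest hα,
    fun q hq => h.scalingFunction_of_le_one hgreatest hq,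
    fun q hq => h.scalingFunction_of_one_lt hleast hq, ⟨b, right_mem_Icc.2 hab.le, ?_⟩,
    ⟨_, hmid', ?_⟩, ?_⟩
  · rintro U hU ⟨x, hxU, hx⟩
    rw [measure_inter_conull Measure.measure_compl_support]
    exact (Measure.mem_support_iff_forall x).1 hx U (hU.mem_nhds hxU)
  · rw [hexp]
    exact hmono.map_isLeast hleast
  · rw [hexp]
    exact hmono.map_isGreatest hgreatest
  · rw [hexp, himg, image_image]
  -- The witness is `b`, which is positive; at `a` the two spectra agree when `a = 0`.
  · rw [hspec b hbexp, hLD b hbexp]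
    exact_mod_cast (ha.trans_lt hab).ne
  · rw [hLD' _ hmid, hLeg _ hmid']
    exact (EReal.coe_ne_bot _).symm
  · intro α hα hα0
    rw [hLeg α hα]
    by_cases hαe : (α : EReal) ∈ Multifractal.exponents (Multifractal.codedMeasure a b)
    · rw [hspec α hαe]
      exact_mod_cast hα0.ne
    · rw [hspec' α hαe]
      exact (EReal.coe_ne_bot _).symm
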